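/- Let $L,T>0$, $\Omega=(0,L)$, $\tfrac12<\alpha<1$, and let $0=x_0<x_1<\dots<x_P=L$. Let $\mathbb S_h$ be the space of continuous functions on $[0,L]$ that are affine on each $[x_{p-1},x_p]$ and vanish at $0$ and $L$. Write $\langle\cdot,\cdot\rangle$ and $\|\cdot\|$ for the inner product and norm of $L_2(\Omega)$, $\|v\|_1^2=\|v\|^2+\|v_x\|^2$, $$I^\alpha v(t)=\int_0^t\frac{(t-s)^{\alpha-1}}{\Gamma(\alpha)}\,v(s)\,ds,\qquad \partial_t^{1-\alpha}v=(I^\alpha v)_t,\qquad E_\beta(z)=\sum_{n=0}^\infty\frac{z^n}{\Gamma(1+n\beta)}.$$ Let $F\in W^1_\infty((0,T);L_\infty(\Omega))$, meaning that $F$ and its weak time derivative are essentially bounded on $\Omega\times(0,T)$, let $g,g_*\in L_1((0,T);L_2(\Omega))$ and $u_{0h}\in\mathbb S_h$, and suppose that $1+F(x,t)^2\le C_F$ for almost all $(x,t)\in\Omega\times(0,T)$. Let $u_h:[0,T]\to\mathbb S_h$ be absolutely continuous with $u_h(0)=u_{0h}$ and, for almost every $t\in(0,T)$, $$\langle u_{ht},v\rangle+\langle\partial_t^{1-\alpha}u_{hx},v_x\rangle-\langle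 F\,\partial_t^{1-\alpha}u_h,v_x\rangle=\langle g(t),v\rangle+\langle g_*(t),v_x\rangle\qquad\text{for all }v\in\mathbb S_h.$$ Then, for $0\le t\le T$, $$\|u_h(t)-u_{0h}\|^2\le\frac{E_{\alpha/2}\bigl(\tfrac58C_Ft^\alpha/(1-\alpha)\bigr)}{(1-\alpha)^2}\left(t^{1-\alpha}\int_0^t\bigl(\tfrac12\|g(s)\|^2+\|g_*(s)\|^2\bigr)\,ds+\frac{C_Ft^\alpha}{2\alpha-1}\,\|u_{0h}\|_1^2\right),$$ where the bound is trivial if the integral on the right is infinite. -/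

import Mathlib

open MeasureTheory Set
open scoped ENNReal

noncomputable section

namespace FracFP

/- Functions of time and space are written `f t x`: a function of `t` whose values are functions
of `x`.  The spatial domain is `Ω = (0, L)`. -/

/-- The kernel `ω_α(t) = t^(α-1) / Γ(α)`. -/
def omega (α t : ℝ) : ℝ := t ^ (α - 1) / Real.Gamma α

/-- The Riemann–Liouville fractional integral `I^α v(t) = ∫₀ᵗ ω_α(t-s) v(s) ds`. -/
def fracIntegral (α : ℝ) (v : ℝ → ℝ) (t : ℝ) : ℝ :=
  ∫ s in (0 : ℝ)..t, omega α (t - s) * v s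

/-- The Riemann–Liouville fractional derivative of order `1 - α`, that is
`∂_t^{1-α} v = (I^α v)_t`. -/
def fracDeriv (α : ℝ) (v : ℝ → ℝ) (t : ℝ) : ℝ := deriv (fracIntegral α v) t

/-- The Mittag-Leffler function `E_β(z) = ∑ zⁿ / Γ(1 + nβ)`.  The series converges for all real
`z` when `β > 0`. -/
def mittagLeffler (β z : ℝ) : ℝ := ∑' n : ℕ, z ^ n / Real.Gamma (1 + n * β)

/-- Lebesgue measure on `(0, a)`. -/
def volOn (a : ℝ) : Measure ℝ := volume.restrict (Ioo 0 a)

/-- The inner product `⟨v, w⟩` of `L₂(0, L)`. -/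
def ip (L : ℝ) (v w : ℝ → ℝ) : ℝ := ∫ x in (0 : ℝ)..L, v x * w x

/-- The square `‖v‖²` of the norm of `L₂(0, L)`, with the value `∞` off `L₂`. -/
def sqNorm (L : ℝ) (v : ℝ → ℝ) : ℝ≥0∞ := eLpNorm v 2 (volOn L) ^ 2

/-- The square `‖v‖₁² = ‖v‖² + ‖v_x‖²` of the norm of `H¹(0, L)`, for continuous piecewise
linear `v` (whose weak derivative is the classical derivative away from the nodes). -/
def sqNormH1 (L : ℝ) (v : ℝ → ℝ) : ℝ≥0∞ := sqNorm L v + sqNorm L (deriv v)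

/-- `𝕊_h`: the continuous functions that are affine on each `[x_{p-1}, x_p]` and vanish at `0` and
`L`.  They are extended by zero to the real line. -/
def feSpace (L : ℝ) {P : ℕ} (node : Fin (P + 1) → ℝ) : Set (ℝ → ℝ) :=
  {v | Continuous v ∧
    (∀ p : Fin P, ∃ a b : ℝ, ∀ x ∈ Icc (node p.castSucc) (node p.succ), v x = a * x + b) ∧
    ∀ x, x ∉ Ioo 0 L → v x = 0}

/-- `g ∈ L₁((0, T); L₂(0, L))`. -/
def MemL1L2 (L T : ℝ) (g : ℝ → ℝ → ℝ) : Prop :=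
  AEStronglyMeasurable (fun z : ℝ × ℝ => g z.1 z.2) ((volOn T).prod (volOn L)) ∧
    ∫⁻ t, eLpNorm (g t) 2 (volOn L) ∂(volOn T) < ∞

/-- `F ∈ W¹_∞((0, T); L_∞(0, L))`: both `F` and its weak time derivative `Ft` are essentially
bounded. -/
def MemW1Inf (L T : ℝ) (F : ℝ → ℝ → ℝ) : Prop :=
  MemLp (fun z : ℝ × ℝ => F z.1 z.2) ∞ ((volOn T).prod (volOn L)) ∧
    ∃ Ft : ℝ → ℝ → ℝ, MemLp (fun z : ℝ × ℝ => Ft z.1 z.2) ∞ ((volOn T).prod (volOn L)) ∧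
      ∀ φ : ℝ → ℝ, ContDiff ℝ (⊤ : ℕ∞) φ → HasCompactSupport φ → tsupport φ ⊆ Ioo 0 T →
        ∀ᵐ x ∂(volOn L),
          ∫ t, F t x * deriv φ t ∂(volOn T) = -∫ t, Ft t x * φ t ∂(volOn T)

/-- `u : [0, T] → 𝕊_h` solves the spatially discrete problem
`⟨u_t, v⟩ + ⟨∂_t^{1-α} u_x, v_x⟩ - ⟨F ∂_t^{1-α} u, v_x⟩ = ⟨g(t), v⟩ + ⟨gs(t), v_x⟩` for all
`v ∈ 𝕊_h`, with `u(0) = u₀`.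

As `g` and `gs` are only integrable in time, the equation is required for almost every `t`, and `u`
is absolutely continuous in time, so that `u_t` is a function.  (`𝕊_h` has finite dimension, so
absolute continuity may be read pointwise in `x`; it makes `I^α u` and `I^α u_x` absolutely
continuous in time as well.) -/
structure IsSemidiscreteSolution (α L T : ℝ) {P : ℕ} (node : Fin (P + 1) → ℝ)
    (F g gs : ℝ → ℝ → ℝ) (u₀ : ℝ → ℝ) (u : ℝ → ℝ → ℝ) : Prop where
  mem : ∀ t ∈ Icc 0 T, u t ∈ feSpace L node
  initial : u 0 = u₀
  absCont : ∀ x ∈ Icc 0 L, AbsolutelyContinuousOnInterval (fun t => u t x) 0 T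
  equation : ∀ᵐ t ∂(volOn T), ∀ v ∈ feSpace L node,
    ip L (fun x => deriv (fun s => u s x) t) v
      + ip L (fun x => fracDeriv α (fun s => deriv (u s) x) t) (deriv v)
      - ip L (fun x => F t x * fracDeriv α (fun s => u s x) t) (deriv v)
    = ip L (g t) v + ip L (gs t) (deriv v)

end FracFP

end

namespace FracFP

/-! Write β = α/2 and let φ be the time derivative of u_h. Since u_h = u_0h + I¹φ, the fractional
derivative of u_h is ω_α u_0h + I^α φ, and I^α φ is an admissible test function. Young's inequality
in space absorbs every gradient of I^α φ and leaves ⟨φ, I^α φ⟩ ≤ ½ C_F ‖I^α φ‖² + ½‖g‖² + ‖g_*‖² +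
C_F ω_α² ‖u_0h‖₁² (`energy_estimate`).

After integration over (0, r), everything is measured by S(r) = ∫₀ʳ ‖I^β φ‖². Coercivity bounds the
left side below by cos(πβ) S(r) ≥ (1-α) S(r) (`cos_mul_setLIntegral_sq_frac_le`). The splitting I^α
= I^β I^β and Jensen bound the first term on the right by a multiple of I^β S
(`setLIntegral_Ioo_sq_frac_two_mul_le`), and ω_α² is integrable because α > 1/2. A fractional
Gronwall inequality of order β (`le_mul_mittagLeffler`) then controls S(t). Finally u_h(t) - u_0h =
(I^{1-β} I^β φ)(t), so Cauchy–Schwarz bounds it by S(t) (`enorm_setIntegral_sq_le`).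

Coercivity comes from an exact identity on the line (`integral_mul_frac_eq`): the correlation of ω_β
with itself is ω_{2β}(|s-q|) / (2 cos πβ), and Fubini does the rest. It is applied to φ square
integrable in time, which absolute continuity alone does not give; this follows by testing with φ
itself and using an inverse inequality on the finite-dimensional space (`derivative_estimate`).
Coordinates in an L₂-orthonormal basis turn spatial norms into finite sums, so the arguments in time
are scalar. -/

theorem lintegral_comp_affine (f : ℝ → ℝ≥0∞) (q : ℝ) {d : ℝ} (hd : 0 < d) :
    ENNReal.ofReal d * ∫⁻ x, f (q + d * x) = ∫⁻ s, f s := by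
  have h1 : ∫⁻ s, f s = ∫⁻ y, f (q + y) := (lintegral_add_left_eq_self f q).symm
  rw [h1]
  conv_rhs => rw [← Real.smul_map_volume_mul_left hd.ne', lintegral_smul_measure,
    (measurableEmbedding_mulLeft₀ hd.ne').lintegral_map]
  simp [abs_of_pos hd]

/-! ### The kernels: semigroup law and self-correlation -/

/-- The kernel `ω_β`, extended by zero to the whole line. -/
noncomputable def ker (β r : ℝ) : ℝ := if 0 < r then omega β r else 0

/-- The extended nonnegative real version of `ker`. -/
noncomputable def kerE (β r : ℝ) : ℝ≥0∞ := ENNReal.ofReal (ker β r)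

theorem ker_of_pos {β r : ℝ} (hr : 0 < r) : ker β r = r ^ (β - 1) / Real.Gamma β := by
  simp [ker, hr, omega]

theorem ker_of_nonpos {β r : ℝ} (hr : r ≤ 0) : ker β r = 0 := by simp [ker, hr.not_gt]

theorem kerE_of_nonpos {β r : ℝ} (hr : r ≤ 0) : kerE β r = 0 := by simp [kerE, ker_of_nonpos hr]

theorem ker_nonneg {β : ℝ} (hβ : 0 < β) (r : ℝ) : 0 ≤ ker β r := by
  rcases lt_or_ge 0 r with h | h
  · rw [ker_of_pos h]
    have := Real.Gamma_pos_of_pos hβ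
    positivity
  · rw [ker_of_nonpos h]

@[fun_prop]
theorem measurable_ker (β : ℝ) : Measurable (ker β) := by
  unfold ker omega
  exact Measurable.ite measurableSet_Ioi (by fun_prop) measurable_const

@[fun_prop]
theorem measurable_kerE (β : ℝ) : Measurable (kerE β) := (measurable_ker β).ennreal_ofReal

theorem enorm_ker {β : ℝ} (hβ : 0 < β) (r : ℝ) : ‖ker β r‖ₑ = kerE β r :=
  Real.enorm_of_nonneg (ker_nonneg hβ r)

theorem kerE_ne_top (β r : ℝ) : kerE β r ≠ ∞ := ENNReal.ofReal_ne_top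

theorem kerE_one_of_pos {r : ℝ} (hr : 0 < r) : kerE 1 r = 1 := by
  simp [kerE, ker_of_pos hr]

theorem kerE_mono {β : ℝ} (hβ : 1 ≤ β) : Monotone (kerE β) := by
  intro r s hrs
  rcases lt_or_ge 0 r with h | h
  · unfold kerE
    rw [ker_of_pos h, ker_of_pos (h.trans_le hrs)]
    have := Real.Gamma_pos_of_pos (by linarith : 0 < β)
    have := Real.rpow_le_rpow h.le hrs (by linarith : 0 ≤ β - 1)
    gcongr
  · simp [kerE_of_nonpos h]

theorem kerE_sq {β : ℝ} (hβ : 0 < β) (r : ℝ) : kerE β r ^ 2 = ENNReal.ofReal (ker β r ^ 2) := by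
  rw [kerE, ENNReal.ofReal_pow (ker_nonneg hβ r)]

/-- The kernels form a convolution semigroup. -/
theorem lintegral_kerE_mul_kerE {a b : ℝ} (ha : 0 < a) (hb : 0 < b) (r q : ℝ) :
    ∫⁻ s, kerE a (r - s) * kerE b (s - q) = kerE (a + b) (r - q) := by
  rcases le_or_gt r q with h | h
  · rw [kerE_of_nonpos (sub_nonpos.2 h), lintegral_eq_zero_iff (by fun_prop)]
    refine ae_of_all _ fun s => ?_
    rcases le_or_gt r s with h1 | h1
    · simp [kerE_of_nonpos (sub_nonpos.2 h1)]
    · simp [kerE_of_nonpos (sub_nonpos.2 (h1.le.trans h))]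
  · have hd : 0 < r - q := sub_pos.2 h
    set d := r - q with hdd
    have hGa := Real.Gamma_pos_of_pos ha
    have hGb := Real.Gamma_pos_of_pos hb
    have hGab := Real.Gamma_pos_of_pos (add_pos ha hb)
    -- Rescaling (q, r) to (0, 1) turns the integrand into a multiple of the beta density, whose
    -- mass is one.
    rw [← lintegral_comp_affine _ q hd]
    have key : ∀ x, kerE a (r - (q + d * x)) * kerE b (q + d * x - q)
        = ENNReal.ofReal (d ^ (a + b - 2) / Real.Gamma (a + b)) *
          ProbabilityTheory.betaPDF b a x := by
      intro x
      have e1 : r - (q + d * x) = d * (1 - x) := by rw [hdd]; ring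
      have e2 : q + d * x - q = d * x := by ring
      rw [e1, e2]
      rcases le_or_gt x 0 with hx | hx
      · rw [ProbabilityTheory.betaPDF_eq_zero_of_nonpos hx,
          kerE_of_nonpos (mul_nonpos_of_nonneg_of_nonpos hd.le hx)]
        simp
      rcases le_or_gt 1 x with hx1 | hx1
      · rw [ProbabilityTheory.betaPDF_eq_zero_of_one_le hx1,
          kerE_of_nonpos (mul_nonpos_of_nonneg_of_nonpos hd.le (sub_nonpos.2 hx1))]
        simp
      have h1x : 0 < 1 - x := by linarith
      rw [ProbabilityTheory.betaPDF_of_pos_lt_one hx hx1, kerE, kerE,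
        ← ENNReal.ofReal_mul (ker_nonneg ha _), ← ENNReal.ofReal_mul (by positivity),
        ker_of_pos (mul_pos hd h1x), ker_of_pos (mul_pos hd hx),
        Real.mul_rpow hd.le h1x.le, Real.mul_rpow hd.le hx.le,
        show a + b - 2 = (a - 1) + (b - 1) by ring, Real.rpow_add hd, ProbabilityTheory.beta,
        add_comm b a]
      congr 1
      field_simp
    simp_rw [key]
    rw [lintegral_const_mul' _ _ ENNReal.ofReal_ne_top,
      ProbabilityTheory.lintegral_betaPDF_eq_one hb ha, mul_one, kerE, ker_of_pos hd,
      ← ENNReal.ofReal_mul hd.le]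
    congr 1
    rw [show a + b - 1 = 1 + (a + b - 2) by ring, Real.rpow_add hd, Real.rpow_one]
    ring

/-- This is the normalisation of the gamma density. It serves as a Laplace transform for powers, to
be read in either direction. -/
theorem lintegral_rpow_mul_exp {a l : ℝ} (ha : 0 < a) (hl : 0 < l) :
    ∫⁻ x in Ioi (0 : ℝ), ENNReal.ofReal (x ^ (a - 1) * Real.exp (-(l * x)))
      = ENNReal.ofReal (Real.Gamma a * l ^ (-a)) := by
  have hG := Real.Gamma_pos_of_pos ha
  have h := ProbabilityTheory.lintegral_gammaPDF_eq_one ha hl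
  have hP : ∀ x, ProbabilityTheory.gammaPDF a l x =
      ENNReal.ofReal (l ^ a / Real.Gamma a) *
        (Ici (0 : ℝ)).indicator
          (fun x => ENNReal.ofReal (x ^ (a - 1) * Real.exp (-(l * x)))) x := by
    intro x
    rcases le_or_gt 0 x with hx | hx
    · rw [ProbabilityTheory.gammaPDF_of_nonneg hx, indicator_of_mem (mem_Ici.2 hx),
        ← ENNReal.ofReal_mul (by positivity)]
      congr 1; ring
    · rw [ProbabilityTheory.gammaPDF_of_neg hx, indicator_of_notMem (by simpa using hx), mul_zero]
  simp_rw [hP] at h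
  rw [lintegral_const_mul' _ _ ENNReal.ofReal_ne_top, lintegral_indicator measurableSet_Ici,
    setLIntegral_congr Ioi_ae_eq_Ici.symm] at h
  calc _ = ENNReal.ofReal (Real.Gamma a * l ^ (-a)) * (ENNReal.ofReal (l ^ a / Real.Gamma a) *
        ∫⁻ x in Ioi (0 : ℝ), ENNReal.ofReal (x ^ (a - 1) * Real.exp (-(l * x)))) := by
        rw [← mul_assoc, ← ENNReal.ofReal_mul (by positivity)]
        have : Real.Gamma a * l ^ (-a) * (l ^ a / Real.Gamma a) = 1 := by
          rw [Real.rpow_neg hl.le]; field_simp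
        rw [this]; simp
    _ = _ := by rw [h, mul_one]

/-- The Stieltjes-type integral `∫₀^∞ x^(b-1) (x+d)^(b-1) dx`. -/
theorem lintegral_rpow_mul_rpow_add {b d : ℝ} (hb : 0 < b) (hb' : b < 1 / 2) (hd : 0 < d) :
    ∫⁻ x in Ioi (0 : ℝ), ENNReal.ofReal (x ^ (b - 1) * (x + d) ^ (b - 1))
      = ENNReal.ofReal
        (Real.Gamma b * Real.Gamma (1 - 2 * b) / Real.Gamma (1 - b) * d ^ (2 * b - 1)) := by
  have hG := Real.Gamma_pos_of_pos hb
  have hG1 := Real.Gamma_pos_of_pos (by linarith : 0 < 1 - b)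
  have hG2 := Real.Gamma_pos_of_pos (by linarith : 0 < 1 - 2 * b)
  -- Represent (x+d)^(b-1) as a Laplace integral in l and swap by Tonelli. The x-integral then
  -- contributes another l^(-b), and l^(-2b) is integrable at 0 exactly because b < 1/2.
  have h1 : ∀ x ∈ Ioi (0 : ℝ), ENNReal.ofReal (x ^ (b - 1) * (x + d) ^ (b - 1)) =
      ENNReal.ofReal (Real.Gamma (1 - b))⁻¹ * ∫⁻ l in Ioi (0 : ℝ),
        ENNReal.ofReal (x ^ (b - 1) * (l ^ (1 - b - 1) * Real.exp (-((x + d) * l)))) := by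
    intro x hx
    have hx : 0 < x := hx
    simp_rw [ENNReal.ofReal_mul (Real.rpow_nonneg hx.le (b - 1))]
    rw [lintegral_const_mul' _ _ ENNReal.ofReal_ne_top,
      lintegral_rpow_mul_exp (by linarith : 0 < 1 - b) (by linarith : 0 < x + d),
      ← ENNReal.ofReal_mul (by positivity), ← ENNReal.ofReal_mul (by positivity),
      ← ENNReal.ofReal_mul (by positivity)]
    congr 1
    rw [show -(1 - b) = b - 1 by ring]
    field_simp
  rw [setLIntegral_congr_fun measurableSet_Ioi h1, lintegral_const_mul' _ _ ENNReal.ofReal_ne_top,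
    lintegral_lintegral_swap]
  swap
  · exact Measurable.aemeasurable (by unfold Function.uncurry; fun_prop)
  have h2 : ∀ l ∈ Ioi (0 : ℝ), ∫⁻ x in Ioi (0 : ℝ),
      ENNReal.ofReal (x ^ (b - 1) * (l ^ (1 - b - 1) * Real.exp (-((x + d) * l)))) =
      ENNReal.ofReal (Real.Gamma b) *
        ENNReal.ofReal (l ^ (1 - 2 * b - 1) * Real.exp (-(d * l))) := by
    intro l hl
    have hl : 0 < l := hl
    have e : ∀ x, x ^ (b - 1) * (l ^ (1 - b - 1) * Real.exp (-((x + d) * l))) =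
        (l ^ (1 - b - 1) * Real.exp (-(d * l))) * (x ^ (b - 1) * Real.exp (-(l * x))) := by
      intro x
      rw [show -((x + d) * l) = -(d * l) + -(l * x) by ring, Real.exp_add]; ring
    simp_rw [e, ENNReal.ofReal_mul (by positivity : 0 ≤ l ^ (1 - b - 1) * Real.exp (-(d * l)))]
    rw [lintegral_const_mul' _ _ ENNReal.ofReal_ne_top, lintegral_rpow_mul_exp hb hl,
      ← ENNReal.ofReal_mul (by positivity), ← ENNReal.ofReal_mul (by positivity),
      show 1 - 2 * b - 1 = (1 - b - 1) + -b by ring, Real.rpow_add hl]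
    congr 1; ring
  rw [setLIntegral_congr_fun measurableSet_Ioi h2, lintegral_const_mul' _ _ ENNReal.ofReal_ne_top,
    lintegral_rpow_mul_exp (by linarith) hd, ← ENNReal.ofReal_mul (by positivity),
    ← ENNReal.ofReal_mul (by positivity)]
  congr 1
  rw [show -(1 - 2 * b) = 2 * b - 1 by ring]
  field_simp

/-- The reflection formula at b and at 2b, together with sin 2πb = 2 sin πb cos πb; the sine cancels
and the cosine remains. -/
theorem gamma_cos_identity {b : ℝ} (hb : 0 < b) (hb' : b < 1 / 2) :
    Real.Gamma b * Real.Gamma (1 - 2 * b) / Real.Gamma (1 - b) / Real.Gamma b ^ 2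
      = 1 / (2 * Real.cos (Real.pi * b)) / Real.Gamma (2 * b) := by
  have hG := Real.Gamma_pos_of_pos hb
  have hG1 := Real.Gamma_pos_of_pos (by linarith : 0 < 1 - b)
  have hG2 := Real.Gamma_pos_of_pos (by linarith : 0 < 1 - 2 * b)
  have hG3 := Real.Gamma_pos_of_pos (by linarith : 0 < 2 * b)
  have hpi := Real.pi_pos
  have hcos : 0 < Real.cos (Real.pi * b) := by
    apply Real.cos_pos_of_mem_Ioo
    constructor <;> nlinarith
  have hsin : 0 < Real.sin (Real.pi * b) := by
    apply Real.sin_pos_of_pos_of_lt_pi <;> nlinarith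
  have e1 := Real.Gamma_mul_Gamma_one_sub b
  have e2 := Real.Gamma_mul_Gamma_one_sub (2 * b)
  rw [show Real.pi * (2 * b) = 2 * (Real.pi * b) by ring, Real.sin_two_mul] at e2
  rw [eq_div_iff (by positivity)] at e1 e2
  generalize Real.cos (Real.pi * b) = c at *
  generalize Real.sin (Real.pi * b) = z at *
  field_simp
  have : Real.pi * (2 * c * Real.Gamma (1 - 2 * b) * Real.Gamma (2 * b) * z)
      = Real.pi * (Real.Gamma (1 - b) * Real.Gamma b * z) := by
    linear_combination Real.pi * e2 - Real.pi * e1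
  have := mul_left_cancel₀ hpi.ne' this
  have := mul_right_cancel₀ hsin.ne' this
  linarith

/-- Correlation of the kernel with itself. -/
theorem lintegral_kerE_sub_mul_kerE_sub {b : ℝ} (hb : 0 < b) (hb' : b < 1 / 2) {s q : ℝ}
    (hsq : s ≠ q) :
    ∫⁻ r, kerE b (r - s) * kerE b (r - q) =
      ENNReal.ofReal (1 / (2 * Real.cos (Real.pi * b))) *
        (kerE (2 * b) (s - q) + kerE (2 * b) (q - s)) := by
  wlog h : q < s generalizing s q
  · have := this hsq.symm (lt_of_le_of_ne (not_lt.1 h) hsq)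
    rw [add_comm, ← this]
    simp_rw [mul_comm]
  have hG := Real.Gamma_pos_of_pos hb
  have hpi := Real.pi_pos
  have hcos : 0 < Real.cos (Real.pi * b) := by
    apply Real.cos_pos_of_mem_Ioo
    constructor <;> nlinarith
  have hd : 0 < s - q := sub_pos.2 h
  rw [kerE_of_nonpos (by linarith : q - s ≤ 0), add_zero,
    ← lintegral_add_left_eq_self _ s]
  have e : ∀ x, kerE b (s + x - s) * kerE b (s + x - q) =
      ENNReal.ofReal (1 / Real.Gamma b ^ 2) * (Ioi (0 : ℝ)).indicator (fun x =>
        ENNReal.ofReal (x ^ (b - 1) * (x + (s - q)) ^ (b - 1))) x := by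
    intro x
    rcases le_or_gt x 0 with hx | hx
    · rw [kerE_of_nonpos (by linarith : s + x - s ≤ 0), indicator_of_notMem (by simpa using hx)]
      simp
    · rw [indicator_of_mem (mem_Ioi.2 hx), show s + x - s = x by ring,
        show s + x - q = x + (s - q) by ring, kerE, kerE, ← ENNReal.ofReal_mul (ker_nonneg hb _),
        ker_of_pos hx, ker_of_pos (by linarith), ← ENNReal.ofReal_mul (by positivity)]
      congr 1; field_simp
  simp_rw [e]
  rw [lintegral_const_mul' _ _ ENNReal.ofReal_ne_top, lintegral_indicator measurableSet_Ioi,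
    lintegral_rpow_mul_rpow_add hb hb' hd, kerE, ker_of_pos hd,
    ← ENNReal.ofReal_mul (by positivity), ← ENNReal.ofReal_mul (by positivity)]
  congr 1
  have := gamma_cos_identity hb hb'
  linear_combination (s - q) ^ (2 * b - 1) * this

/-! ### Fractional integrals on the whole line -/

/-- The fractional integral of a nonnegative function on the whole line. -/
noncomputable def fracE (β : ℝ) (f : ℝ → ℝ≥0∞) (r : ℝ) : ℝ≥0∞ := ∫⁻ s, kerE β (r - s) * f s

/-- The fractional integral of a function on the whole line. -/
noncomputable def frac (β : ℝ) (f : ℝ → ℝ) (r : ℝ) : ℝ := ∫ s, ker β (r - s) * f s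

@[fun_prop]
theorem measurable_fracE (β : ℝ) {f : ℝ → ℝ≥0∞} (hf : Measurable f) : Measurable (fracE β f) := by
  unfold fracE
  exact Measurable.lintegral_prod_right' (f := fun z : ℝ × ℝ => kerE β (z.1 - z.2) * f z.2)
    (by fun_prop)

@[fun_prop]
theorem measurable_frac (β : ℝ) {f : ℝ → ℝ} (hf : Measurable f) : Measurable (frac β f) := by
  unfold frac
  have h : Measurable (fun z : ℝ × ℝ => ker β (z.1 - z.2) * f z.2) := by fun_prop
  exact h.stronglyMeasurable.integral_prod_right'.measurable

theorem fracE_mono (β : ℝ) {f g : ℝ → ℝ≥0∞} {r : ℝ} (h : ∀ s < r, f s ≤ g s) :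
    fracE β f r ≤ fracE β g r := by
  refine lintegral_mono fun s => ?_
  rcases lt_or_ge s r with h1 | h1
  · exact mul_le_mul_right (h s h1) _
  · simp [kerE_of_nonpos (sub_nonpos.2 h1)]

theorem fracE_fracE {a b : ℝ} (ha : 0 < a) (hb : 0 < b) {f : ℝ → ℝ≥0∞} (hf : Measurable f)
    (r : ℝ) : fracE a (fracE b f) r = fracE (a + b) f r := by
  unfold fracE
  calc _ = ∫⁻ s, ∫⁻ q, kerE a (r - s) * (kerE b (s - q) * f q) := by
        refine lintegral_congr fun s => ?_
        rw [lintegral_const_mul' _ _ (kerE_ne_top _ _)]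
    _ = ∫⁻ q, ∫⁻ s, kerE a (r - s) * (kerE b (s - q) * f q) :=
        lintegral_lintegral_swap
          (Measurable.aemeasurable (by unfold Function.uncurry; fun_prop))
    _ = _ := by
        refine lintegral_congr fun q => ?_
        rw [← lintegral_kerE_mul_kerE ha hb, ← lintegral_mul_const _ (by fun_prop)]
        simp_rw [mul_assoc]

theorem fracE_add (β : ℝ) {f g : ℝ → ℝ≥0∞} (hf : Measurable f) (r : ℝ) :
    fracE β (fun s => f s + g s) r = fracE β f r + fracE β g r := by
  unfold fracE
  simp_rw [mul_add]
  rw [lintegral_add_left (by fun_prop)]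

theorem fracE_const_mul (β : ℝ) (c : ℝ≥0∞) {f : ℝ → ℝ≥0∞} (hf : Measurable f) (r : ℝ) :
    fracE β (fun s => c * f s) r = c * fracE β f r := by
  unfold fracE
  rw [← lintegral_const_mul _ (by fun_prop)]
  simp_rw [mul_left_comm]

theorem fracE_kerE {a b : ℝ} (ha : 0 < a) (hb : 0 < b) (r : ℝ) :
    fracE a (kerE b) r = kerE (a + b) r := by
  have := lintegral_kerE_mul_kerE ha hb r 0
  simpa [fracE] using this

theorem fracE_one (f : ℝ → ℝ≥0∞) (r : ℝ) : fracE 1 f r = ∫⁻ s in Iio r, f s := by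
  unfold fracE
  rw [← lintegral_indicator measurableSet_Iio]
  refine lintegral_congr fun s => ?_
  rcases lt_or_ge s r with h1 | h1
  · rw [kerE_one_of_pos (sub_pos.2 h1), indicator_of_mem (mem_Iio.2 h1), one_mul]
  · simp [kerE_of_nonpos (sub_nonpos.2 h1), h1]

/-- Plain integration over (0, r) is fractional integration of order one, so the semigroup law also
covers integrated inequalities. -/
theorem setLIntegral_Ioo_eq_fracE {f : ℝ → ℝ≥0∞} (h0 : ∀ s ≤ 0, f s = 0) (r : ℝ) :
    ∫⁻ s in Ioo 0 r, f s = fracE 1 f r := by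
  rw [fracE_one, ← lintegral_indicator measurableSet_Iio, ← lintegral_indicator measurableSet_Ioo]
  refine lintegral_congr fun s => ?_
  rcases le_or_gt s 0 with h | h
  · simp [indicator, h0 s h]
  · simp [indicator, h]

theorem fracE_eq_zero {β : ℝ} {f : ℝ → ℝ≥0∞} (h0 : ∀ s ≤ 0, f s = 0) {r : ℝ} (hr : r ≤ 0) :
    fracE β f r = 0 := by
  unfold fracE
  rw [lintegral_eq_zero_of_ae_eq_zero]
  refine ae_of_all _ fun s => ?_
  rcases le_or_gt s 0 with h | h
  · simp [h0 s h]
  · simp [kerE_of_nonpos (by linarith : r - s ≤ 0)]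

/-- For orders at least one the kernel is bounded on bounded intervals. -/
theorem fracE_le {β : ℝ} (hβ : 1 ≤ β) {f : ℝ → ℝ≥0∞} (hf : Measurable f)
    (h0 : ∀ s ≤ 0, f s = 0) (r : ℝ) : fracE β f r ≤ kerE β r * ∫⁻ s, f s := by
  rw [← lintegral_const_mul _ hf]
  refine lintegral_mono fun s => ?_
  rcases le_or_gt s 0 with h | h
  · simp [h0 s h]
  · exact mul_le_mul_left (kerE_mono hβ (by linarith)) _

theorem sq_lintegral_mul_le {k f : ℝ → ℝ≥0∞} (hk : Measurable k) (hf : Measurable f) :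
    (∫⁻ s, k s * f s) ^ 2 ≤ (∫⁻ s, k s ^ 2) * ∫⁻ s, f s ^ 2 := by
  have h := ENNReal.lintegral_mul_le_Lp_mul_Lq volume
    (Real.HolderConjugate.two_two) hk.aemeasurable hf.aemeasurable
  calc _ ≤ _ := pow_le_pow_left' h 2
    _ = _ := by
      simp only [ENNReal.rpow_two]
      rw [mul_pow, ← ENNReal.rpow_two, ← ENNReal.rpow_two, ← ENNReal.rpow_mul, ← ENNReal.rpow_mul]
      norm_num

/-- Cauchy–Schwarz after splitting the weight as √k · √k; in extended nonnegative reals no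
finiteness is needed. -/
theorem sq_lintegral_weight_mul_le {k f : ℝ → ℝ≥0∞} (hk : Measurable k) (hf : Measurable f) :
    (∫⁻ s, k s * f s) ^ 2 ≤ (∫⁻ s, k s) * ∫⁻ s, k s * f s ^ 2 := by
  have h := sq_lintegral_mul_le (k := fun s => k s ^ (1 / 2 : ℝ))
    (f := fun s => k s ^ (1 / 2 : ℝ) * f s) (by fun_prop) (by fun_prop)
  have e : ∀ x : ℝ≥0∞, (x ^ (1 / 2 : ℝ)) ^ 2 = x := fun x => by
    rw [← ENNReal.rpow_two, ← ENNReal.rpow_mul]; norm_num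
  have e' : ∀ x : ℝ≥0∞, x ^ (1 / 2 : ℝ) * x ^ (1 / 2 : ℝ) = x := fun x => by
    rw [← sq, e]
  simpa only [mul_pow, e, ← mul_assoc, e'] using h

/-- Jensen's inequality for fractional integrals. -/
theorem sq_fracE_le {β : ℝ} (hβ : 0 < β) {f : ℝ → ℝ≥0∞} (hf : Measurable f)
    (h0 : ∀ s ≤ 0, f s = 0) (r : ℝ) :
    fracE β f r ^ 2 ≤ kerE (1 + β) r * fracE β (fun s => f s ^ 2) r := by
  -- The factor `kerE 1 s` cuts the weight to s > 0, which makes its mass finite: it is I^β 1 =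
  -- ω_{1+β} at r.
  have h := sq_lintegral_weight_mul_le (k := fun s => kerE β (r - s) * kerE 1 s) (f := f)
    (by fun_prop) hf
  have e : ∀ g : ℝ → ℝ≥0∞, (∀ s ≤ 0, g s = 0) →
      ∫⁻ s, kerE β (r - s) * kerE 1 s * g s = fracE β g r := fun g hg => by
    refine lintegral_congr fun s => ?_
    rcases le_or_gt s 0 with h | h
    · simp [hg s h]
    · rw [kerE_one_of_pos h, mul_one]
  rw [e f h0, e _ (fun s hs => by simp [h0 s hs])] at h
  have e2 := lintegral_kerE_mul_kerE hβ one_pos r 0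
  simp only [sub_zero] at e2
  rwa [e2, add_comm] at h

theorem enorm_frac_le {β : ℝ} (hβ : 0 < β) (f : ℝ → ℝ) (r : ℝ) :
    ‖frac β f r‖ₑ ≤ fracE β (fun s => ‖f s‖ₑ) r := by
  refine (enorm_integral_le_lintegral_enorm _).trans (le_of_eq ?_)
  refine lintegral_congr fun s => ?_
  rw [enorm_mul, enorm_ker hβ]

/-- By Tonelli, the finiteness assumption is exactly absolute integrability of the double integral,
so Fubini applies at the single point r. -/
theorem frac_frac {a b : ℝ} (ha : 0 < a) (hb : 0 < b) {f : ℝ → ℝ} (hf : Measurable f) {r : ℝ}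
    (hfin : fracE (a + b) (fun s => ‖f s‖ₑ) r ≠ ∞) :
    frac a (frac b f) r = frac (a + b) f r := by
  have hint : Integrable (fun z : ℝ × ℝ => ker a (r - z.1) * (ker b (z.1 - z.2) * f z.2))
      (volume.prod volume) := by
    refine ⟨Measurable.aestronglyMeasurable (by fun_prop), ?_⟩
    rw [HasFiniteIntegral, lintegral_prod _ (Measurable.aemeasurable (by fun_prop))]
    rw [← fracE_fracE ha hb (by fun_prop)] at hfin
    refine lt_of_eq_of_lt ?_ (lt_top_iff_ne_top.2 hfin)
    refine lintegral_congr fun s => ?_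
    simp only [enorm_mul, enorm_ker ha, enorm_ker hb]
    rw [lintegral_const_mul' _ _ (kerE_ne_top _ _)]
    rfl
  unfold frac
  calc _ = ∫ s, ∫ q, ker a (r - s) * (ker b (s - q) * f q) := by
        simp_rw [integral_const_mul]
    _ = ∫ q, ∫ s, ker a (r - s) * (ker b (s - q) * f q) := integral_integral_swap hint
    _ = _ := by
        refine integral_congr_ae (ae_of_all _ fun q => ?_)
        simp_rw [← mul_assoc, integral_mul_const]
        congr 1
        rw [integral_eq_lintegral_of_nonneg_ae
          (ae_of_all _ fun s => mul_nonneg (ker_nonneg ha _) (ker_nonneg hb _))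
          (Measurable.aestronglyMeasurable (by fun_prop))]
        simp_rw [ENNReal.ofReal_mul (ker_nonneg ha _)]
        rw [show ker (a + b) (r - q) = (kerE (a + b) (r - q)).toReal from
          (ENNReal.toReal_ofReal (ker_nonneg (add_pos ha hb) _)).symm,
          ← lintegral_kerE_mul_kerE ha hb]
        rfl

/-! ### Energy identity, coercivity and the L₂ bounds in time -/

/-- The correlation formula fails on the diagonal, where the left side diverges; the diagonal must
therefore be null. -/
theorem ae_ne_prod : ∀ᵐ z : ℝ × ℝ ∂((volume : Measure ℝ).prod volume), z.1 ≠ z.2 := by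
  have h : MeasurableSet {z : ℝ × ℝ | z.1 = z.2} := measurableSet_eq_fun measurable_fst measurable_snd
  rw [ae_iff]
  simp only [ne_eq, not_not]
  rw [Measure.measure_prod_null h]
  refine ae_of_all _ fun x => ?_
  have : Prod.mk x ⁻¹' {z : ℝ × ℝ | z.1 = z.2} = {x} := by ext y; simp [eq_comm]
  simp only [this]; simp

theorem lintegral_prod_mul_kerE {b : ℝ} {f : ℝ → ℝ≥0∞} (hf : Measurable f) :
    ∫⁻ z : ℝ × ℝ, f z.1 * f z.2 * kerE b (z.1 - z.2) ∂(volume.prod volume)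
      = ∫⁻ s, f s * fracE b f s := by
  rw [lintegral_prod _ (Measurable.aemeasurable (by fun_prop))]
  refine lintegral_congr fun s => ?_
  unfold fracE
  rw [← lintegral_const_mul _ (by fun_prop)]
  refine lintegral_congr fun q => ?_
  simp only; ring

theorem lintegral_prod_mul_kerE' {b : ℝ} {f : ℝ → ℝ≥0∞} (hf : Measurable f) :
    ∫⁻ z : ℝ × ℝ, f z.1 * f z.2 * kerE b (z.2 - z.1) ∂(volume.prod volume)
      = ∫⁻ s, f s * fracE b f s := by
  rw [← lintegral_prod_mul_kerE hf, ← lintegral_prod_swap]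
  refine lintegral_congr fun z => ?_
  simp only [Prod.fst_swap, Prod.snd_swap]; ring

theorem cos_pi_mul_pos {b : ℝ} (hb : 0 < b) (hb' : b < 1 / 2) : 0 < Real.cos (Real.pi * b) := by
  have hpi := Real.pi_pos
  apply Real.cos_pos_of_mem_Ioo
  constructor <;> nlinarith

/-- The energy identity for the Riemann--Liouville integral on the whole line. -/
theorem integral_mul_frac_eq {b : ℝ} (hb : 0 < b) (hb' : b < 1 / 2) {f : ℝ → ℝ}
    (hf : Measurable f)
    (hfin : ∫⁻ s, ‖f s‖ₑ * fracE (2 * b) (fun s => ‖f s‖ₑ) s ≠ ∞) :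
    Integrable (fun r => frac b f r ^ 2) ∧ Integrable (fun r => f r * frac (2 * b) f r) ∧
      ∫ r, f r * frac (2 * b) f r = Real.cos (Real.pi * b) * ∫ r, frac b f r ^ 2 := by
  have hcos := cos_pi_mul_pos hb hb'
  set c := 1 / (2 * Real.cos (Real.pi * b)) with hc
  have hc0 : 0 < c := by positivity
  have h2b : 0 < 2 * b := by linarith
  -- Integrating H over (s, q) gives (I^b f)²(r); integrating it over r gives, by the correlation
  -- formula, c times the symmetrised energy density G + G'. Fubini equates the two, and 2c = 1 /
  -- cos πb.
  let H : ℝ × (ℝ × ℝ) → ℝ := fun w =>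
    (ker b (w.1 - w.2.1) * f w.2.1) * (ker b (w.1 - w.2.2) * f w.2.2)
  have hHm : Measurable H := by fun_prop
  let G : ℝ × ℝ → ℝ := fun z => f z.1 * f z.2 * ker (2 * b) (z.1 - z.2)
  let G' : ℝ × ℝ → ℝ := fun z => f z.1 * f z.2 * ker (2 * b) (z.2 - z.1)
  have hG : Integrable G (volume.prod volume) := by
    refine ⟨Measurable.aestronglyMeasurable (by fun_prop), ?_⟩
    rw [HasFiniteIntegral]
    simp only [G, enorm_mul, enorm_ker h2b]
    rw [lintegral_prod_mul_kerE (f := fun s => ‖f s‖ₑ) (by fun_prop)]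
    exact lt_top_iff_ne_top.2 hfin
  have hG' : Integrable G' (volume.prod volume) := by
    refine ⟨Measurable.aestronglyMeasurable (by fun_prop), ?_⟩
    rw [HasFiniteIntegral]
    simp only [G', enorm_mul, enorm_ker h2b]
    rw [lintegral_prod_mul_kerE' (f := fun s => ‖f s‖ₑ) (by fun_prop)]
    exact lt_top_iff_ne_top.2 hfin
  have hfG : ∀ s, ∫ q, G (s, q) = f s * frac (2 * b) f s := by
    intro s
    unfold frac
    rw [← integral_const_mul]
    refine integral_congr_ae (ae_of_all _ fun q => ?_)
    simp only [G]; ring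
  have hGint : ∫ z, G z ∂(volume.prod volume) = ∫ s, f s * frac (2 * b) f s := by
    rw [integral_prod _ hG]
    simp_rw [hfG]
  have hGint' : ∫ z, G' z ∂(volume.prod volume) = ∫ s, f s * frac (2 * b) f s := by
    rw [← hGint, ← integral_prod_swap]
    refine integral_congr_ae (ae_of_all _ fun z => ?_)
    simp only [G, G', Prod.fst_swap, Prod.snd_swap]; ring
  have hH : Integrable H (volume.prod (volume.prod volume)) := by
    refine ⟨hHm.aestronglyMeasurable, ?_⟩
    rw [HasFiniteIntegral, lintegral_prod_symm _ hHm.enorm.aemeasurable]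
    have : ∀ᵐ z : ℝ × ℝ ∂(volume.prod volume), ∫⁻ r, ‖H (r, z)‖ₑ =
        ENNReal.ofReal c * (‖G z‖ₑ + ‖G' z‖ₑ) := by
      filter_upwards [ae_ne_prod] with z hz
      simp only [H, G, G', enorm_mul, enorm_ker hb, enorm_ker h2b]
      have e : ∀ r, kerE b (r - z.1) * ‖f z.1‖ₑ * (kerE b (r - z.2) * ‖f z.2‖ₑ) =
        (‖f z.1‖ₑ * ‖f z.2‖ₑ) * (kerE b (r - z.1) * kerE b (r - z.2)) := fun r => by ring
      simp_rw [e]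
      rw [lintegral_const_mul _ (by fun_prop), lintegral_kerE_sub_mul_kerE_sub hb hb' hz]
      ring
    rw [lintegral_congr_ae this, lintegral_const_mul' _ _ ENNReal.ofReal_ne_top,
      lintegral_add_left' hG.1.enorm]
    exact ENNReal.mul_lt_top ENNReal.ofReal_lt_top (ENNReal.add_lt_top.2 ⟨hG.2, hG'.2⟩)
  have hsq : ∀ r, frac b f r ^ 2 = ∫ z, H (r, z) ∂(volume.prod volume) := by
    intro r
    rw [sq]
    exact (integral_prod_mul (fun s => ker b (r - s) * f s) (fun s => ker b (r - s) * f s)).symm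
  have hz : ∀ᵐ z : ℝ × ℝ ∂(volume.prod volume), ∫ r, H (r, z) = c * (G z + G' z) := by
    filter_upwards [ae_ne_prod] with z hz
    have e : ∀ r, H (r, z) = (f z.1 * f z.2) * (ker b (r - z.1) * ker b (r - z.2)) :=
      fun r => by simp only [H]; ring
    simp_rw [e]
    rw [integral_const_mul, integral_eq_lintegral_of_nonneg_ae
          (ae_of_all _ fun s => mul_nonneg (ker_nonneg hb _) (ker_nonneg hb _))
          (Measurable.aestronglyMeasurable (by fun_prop))]
    simp_rw [ENNReal.ofReal_mul (ker_nonneg hb _)]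
    have := lintegral_kerE_sub_mul_kerE_sub hb hb' hz
    unfold kerE at this
    rw [this, ENNReal.toReal_mul, ENNReal.toReal_add ENNReal.ofReal_ne_top ENNReal.ofReal_ne_top,
      ENNReal.toReal_ofReal (by positivity), ENNReal.toReal_ofReal (ker_nonneg h2b _),
      ENNReal.toReal_ofReal (ker_nonneg h2b _)]
    simp only [G, G']; ring
  refine ⟨?_, ?_, ?_⟩
  · simp_rw [hsq]; exact hH.integral_prod_left
  · simp_rw [← hfG]; exact hG.integral_prod_left
  · simp_rw [hsq]
    rw [integral_integral_swap (f := fun r z => H (r, z)) hH, integral_congr_ae hz,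
      integral_const_mul, integral_add hG hG', hGint, hGint', hc]
    generalize Real.cos (Real.pi * b) = x at *
    generalize ∫ r, f r * frac (2 * b) f r = y
    field_simp
    ring

/-- Jensen at each s; the mass ω_{1+β}(s) is increasing, so its value at r can be pulled out, and
the outer integral merges with I^β by the semigroup law. -/
theorem setLIntegral_Ioo_sq_fracE_le {β : ℝ} (hβ : 0 < β) {f : ℝ → ℝ≥0∞} (hf : Measurable f)
    (h0 : ∀ s ≤ 0, f s = 0) (r : ℝ) :
    ∫⁻ s in Ioo 0 r, fracE β f s ^ 2 ≤ kerE (1 + β) r * fracE (1 + β) (fun s => f s ^ 2) r := by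
  have h0' : ∀ s ≤ 0, f s ^ 2 = 0 := fun s hs => by simp [h0 s hs]
  calc _ ≤ ∫⁻ s in Ioo 0 r, kerE (1 + β) r * fracE β (fun s => f s ^ 2) s := by
        refine setLIntegral_mono (by fun_prop) fun s hs => (sq_fracE_le hβ hf h0 s).trans ?_
        exact mul_le_mul_left (kerE_mono (by linarith) hs.2.le) _
    _ = _ := by
        rw [lintegral_const_mul _ (by fun_prop), setLIntegral_Ioo_eq_fracE
          (fun s hs => fracE_eq_zero h0' hs), fracE_fracE one_pos hβ (by fun_prop)]

theorem setLIntegral_Ioo_sq_fracE_lt_top {β : ℝ} (hβ : 0 < β) {f : ℝ → ℝ≥0∞} (hf : Measurable f)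
    (h0 : ∀ s ≤ 0, f s = 0) (h2 : ∫⁻ s, f s ^ 2 ≠ ∞) (r : ℝ) :
    ∫⁻ s in Ioo 0 r, fracE β f s ^ 2 < ∞ := by
  refine (setLIntegral_Ioo_sq_fracE_le hβ hf h0 r).trans_lt ?_
  refine ENNReal.mul_lt_top (kerE_ne_top _ _).lt_top ?_
  refine (fracE_le (by linarith) (by fun_prop) (fun s hs => by simp [h0 s hs]) r).trans_lt ?_
  exact ENNReal.mul_lt_top (kerE_ne_top _ _).lt_top h2.lt_top

/-- Squares of kernels stay within the family, so L₂ norms of kernels reduce to the semigroup law; a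
> 1/2 keeps the new order positive. -/
theorem kerE_sq_eq {a : ℝ} (ha : 1 / 2 < a) (s : ℝ) :
    kerE a s ^ 2 = ENNReal.ofReal (Real.Gamma (2 * a - 1) / Real.Gamma a ^ 2)
      * kerE (2 * a - 1) s := by
  rcases le_or_gt s 0 with h | h
  · simp [kerE_of_nonpos h]
  · have h1 := Real.Gamma_pos_of_pos (by linarith : 0 < a)
    have h2 := Real.Gamma_pos_of_pos (by linarith : 0 < 2 * a - 1)
    rw [kerE_sq (by linarith), kerE, ← ENNReal.ofReal_mul (by positivity), ker_of_pos h,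
      ker_of_pos h, show 2 * a - 1 - 1 = (a - 1) + (a - 1) by ring, Real.rpow_add h]
    congr 1
    generalize Real.Gamma (2 * a - 1) = G at *
    field_simp

theorem ofReal_mul_kerE_two_mul {a r : ℝ} (ha : 1 / 2 < a) (hr : 0 < r) :
    ENNReal.ofReal (Real.Gamma (2 * a - 1) / Real.Gamma a ^ 2) * kerE (2 * a) r
      = ENNReal.ofReal (r ^ (2 * a - 1) / ((2 * a - 1) * Real.Gamma a ^ 2)) := by
  have h1 := Real.Gamma_pos_of_pos (by linarith : 0 < a)
  have h3 : 0 < 2 * a - 1 := by linarith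
  have h2 := Real.Gamma_pos_of_pos h3
  have h4 : Real.Gamma (2 * a) = (2 * a - 1) * Real.Gamma (2 * a - 1) := by
    rw [← Real.Gamma_add_one h3.ne']; congr 1; ring
  rw [kerE, ← ENNReal.ofReal_mul (by positivity), ker_of_pos hr, h4]
  congr 1
  field_simp

theorem setLIntegral_Ioo_kerE_sq {a r : ℝ} (ha : 1 / 2 < a) (hr : 0 < r) :
    ∫⁻ s in Ioo 0 r, kerE a s ^ 2
      = ENNReal.ofReal (r ^ (2 * a - 1) / ((2 * a - 1) * Real.Gamma a ^ 2)) := by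
  simp_rw [kerE_sq_eq ha]
  rw [lintegral_const_mul _ (by fun_prop),
    setLIntegral_Ioo_eq_fracE (fun s hs => kerE_of_nonpos hs),
    fracE_kerE one_pos (by linarith), ← ofReal_mul_kerE_two_mul ha hr]
  congr 2; ring

/-- Square integrability of the fractional integral of an integrable function. -/
theorem setLIntegral_Ioo_sq_fracE_lt_top_of_integrable {a : ℝ} (ha : 1 / 2 < a) {f : ℝ → ℝ≥0∞}
    (hf : Measurable f) (h0 : ∀ s ≤ 0, f s = 0) (h1 : ∫⁻ s, f s ≠ ∞) (r : ℝ) :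
    ∫⁻ s in Ioo 0 r, fracE a f s ^ 2 < ∞ := by
  set c := ENNReal.ofReal (Real.Gamma (2 * a - 1) / Real.Gamma a ^ 2) with hc
  have key : ∀ s, fracE a f s ^ 2 ≤ (∫⁻ s, f s) * (c * fracE (2 * a - 1) f s) := by
    intro s
    -- Here the integrable function is the weight and the kernel is squared, since f itself need not
    -- be square integrable.
    have h := sq_lintegral_weight_mul_le (k := f) (f := fun q => kerE a (s - q)) hf (by fun_prop)
    simp_rw [mul_comm (f _)] at h
    refine h.trans_eq ?_
    unfold fracE
    congr 1
    rw [← lintegral_const_mul _ (by fun_prop)]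
    simp_rw [kerE_sq_eq ha, ← hc, mul_assoc]
  calc _ ≤ ∫⁻ s in Ioo 0 r, (∫⁻ s, f s) * (c * fracE (2 * a - 1) f s) :=
        lintegral_mono fun s => key s
    _ = (∫⁻ s, f s) * (c * fracE (2 * a) f r) := by
        rw [lintegral_const_mul _ (by fun_prop), lintegral_const_mul _ (by fun_prop),
          setLIntegral_Ioo_eq_fracE (fun s hs => fracE_eq_zero h0 hs),
          fracE_fracE one_pos (by linarith) hf]
        congr 3; ring
    _ < ∞ := by
        refine ENNReal.mul_lt_top h1.lt_top (ENNReal.mul_lt_top ENNReal.ofReal_lt_top ?_)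
        exact (fracE_le (by linarith) hf h0 r).trans_lt
          (ENNReal.mul_lt_top (kerE_ne_top _ _).lt_top h1.lt_top)

/-- Causality: values of f beyond r do not influence its fractional integral up to r. -/
theorem frac_indicator_Iio (β : ℝ) (f : ℝ → ℝ) {r s : ℝ} (hs : s ≤ r) :
    frac β ((Iio r).indicator f) s = frac β f s := by
  unfold frac
  refine integral_congr_ae (ae_of_all _ fun q => ?_)
  rcases lt_or_ge q s with h | h
  · simp [indicator_of_mem (mem_Iio.2 (h.trans_le hs))]
  · simp [ker_of_nonpos (sub_nonpos.2 h)]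

theorem frac_eq_zero {β : ℝ} {f : ℝ → ℝ} (h0 : ∀ s ≤ 0, f s = 0) {r : ℝ} (hr : r ≤ 0) :
    frac β f r = 0 := by
  unfold frac
  rw [integral_eq_zero_of_ae]
  refine ae_of_all _ fun s => ?_
  rcases le_or_gt s 0 with h | h
  · simp [h0 s h]
  · simp [ker_of_nonpos (by linarith : r - s ≤ 0)]

/-- Coercivity of the Riemann--Liouville integral. -/
theorem cos_mul_setLIntegral_sq_frac_le {b : ℝ} (hb : 0 < b) (hb' : b < 1 / 2) {f : ℝ → ℝ}
    (hf : Measurable f) (h0 : ∀ s ≤ 0, f s = 0) (h2 : ∫⁻ s, ‖f s‖ₑ ^ 2 ≠ ∞) (r : ℝ) :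
    IntegrableOn (fun s => f s * frac (2 * b) f s) (Ioo 0 r) ∧
    0 ≤ ∫ s in Ioo 0 r, f s * frac (2 * b) f s ∧
    ∫⁻ s in Ioo 0 r, ‖frac b f s‖ₑ ^ 2 < ∞ ∧
    ENNReal.ofReal (Real.cos (Real.pi * b)) * ∫⁻ s in Ioo 0 r, ‖frac b f s‖ₑ ^ 2 ≤
      ENNReal.ofReal (∫ s in Ioo 0 r, f s * frac (2 * b) f s) := by
  have hcos := cos_pi_mul_pos hb hb'
  -- Truncating at r reduces the claim to the identity on the whole line. By causality the energy of
  -- g is the energy of f over (0, r).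
  set g := (Iio r).indicator f with hg
  have hgm : Measurable g := hf.indicator measurableSet_Iio
  have hgf : ∀ s, ‖g s‖ₑ ≤ ‖f s‖ₑ := fun s => by
    rcases lt_or_ge s r with h | h
    · simp [hg, h]
    · simp [hg, h.not_gt]
  have hg0 : ∀ s ≤ 0, g s = 0 := fun s hs => by simp [hg, indicator, h0 s hs]
  have hg2 : ∫⁻ s, ‖g s‖ₑ ^ 2 ≠ ∞ :=
    ne_top_of_le_ne_top h2 (lintegral_mono fun s => pow_le_pow_left' (hgf s) 2)
  have hg0' : ∀ s ≤ 0, ‖g s‖ₑ = 0 := fun s hs => by simp [hg0 s hs]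
  -- Cauchy–Schwarz, using that I^{2b} maps L₂ into L₂ on bounded intervals.
  have hfin : ∫⁻ s, ‖g s‖ₑ * fracE (2 * b) (fun s => ‖g s‖ₑ) s ≠ ∞ := by
    have h := sq_lintegral_mul_le (k := fun s => ‖g s‖ₑ)
      (f := (Ioo 0 r).indicator (fracE (2 * b) (fun s => ‖g s‖ₑ))) (by fun_prop)
      ((measurable_fracE _ (by fun_prop)).indicator measurableSet_Ioo)
    have e1 : ∀ s, ‖g s‖ₑ * (Ioo 0 r).indicator (fracE (2 * b) (fun s => ‖g s‖ₑ)) s =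
        ‖g s‖ₑ * fracE (2 * b) (fun s => ‖g s‖ₑ) s := fun s => by
      rcases le_or_gt s 0 with h | h
      · simp [hg0 s h]
      rcases lt_or_ge s r with h' | h'
      · rw [indicator_of_mem (mem_Ioo.2 ⟨h, h'⟩)]
      · have : g s = 0 := by simp [hg, h']
        simp [this]
    have e2 : ∀ s, (Ioo 0 r).indicator (fracE (2 * b) (fun s => ‖g s‖ₑ)) s ^ 2 =
        (Ioo 0 r).indicator (fun s => fracE (2 * b) (fun s => ‖g s‖ₑ) s ^ 2) s := fun s => by
      by_cases h : s ∈ Ioo 0 r <;> simp [h]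
    simp_rw [e1, e2] at h
    rw [lintegral_indicator measurableSet_Ioo] at h
    have h3 := h.trans_lt (ENNReal.mul_lt_top hg2.lt_top (setLIntegral_Ioo_sq_fracE_lt_top
      (by linarith : 0 < 2 * b) (by fun_prop) hg0' hg2 r))
    intro h4
    rw [h4] at h3
    simp at h3
  obtain ⟨i1, i2, i3⟩ := integral_mul_frac_eq hb hb' hgm hfin
  have eg : ∀ s, g s * frac (2 * b) g s =
      (Ioo 0 r).indicator (fun s => f s * frac (2 * b) f s) s := fun s => by
    rcases le_or_gt s 0 with h | h
    · simp [hg0 s h, h.not_gt]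
    rcases lt_or_ge s r with h' | h'
    · rw [indicator_of_mem (mem_Ioo.2 ⟨h, h'⟩), frac_indicator_Iio _ _ h'.le, hg,
        indicator_of_mem (mem_Iio.2 h')]
    · have : g s = 0 := by simp [hg, h']
      simp [this, h'.not_gt]
  -- Only an inequality: the tail of I^b g beyond r is discarded.
  have el : ∫⁻ s in Ioo 0 r, ‖frac b f s‖ₑ ^ 2 ≤ ENNReal.ofReal (∫ s, frac b g s ^ 2) := by
    rw [ofReal_integral_eq_lintegral_ofReal i1 (ae_of_all _ fun s => sq_nonneg _),
      ← lintegral_indicator measurableSet_Ioo]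
    refine lintegral_mono fun s => ?_
    by_cases h : s ∈ Ioo 0 r
    · rw [indicator_of_mem h, frac_indicator_Iio _ _ h.2.le, ← sq_abs (frac b f s),
        ENNReal.ofReal_pow (abs_nonneg _), ← Real.enorm_eq_ofReal_abs]
    · simp [h]
  simp_rw [eg] at i2 i3
  rw [integral_indicator measurableSet_Ioo] at i3
  refine ⟨(integrable_indicator_iff measurableSet_Ioo).1 i2, ?_,
    el.trans_lt ENNReal.ofReal_lt_top, ?_⟩
  · rw [i3]
    exact mul_nonneg hcos.le (integral_nonneg fun s => sq_nonneg _)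
  · rw [i3, ENNReal.ofReal_mul hcos.le]
    exact mul_le_mul_right el _

/-- Split I^{2b} = I^b I^b and apply Jensen to the outer factor only. The orders are commuted so
that I^b acts on the running integral of |I^b f|², the form required by Gronwall. The splitting is
used only almost everywhere, where the integral of |f| is finite. -/
theorem setLIntegral_Ioo_sq_frac_two_mul_le {b : ℝ} (hb : 0 < b) {f : ℝ → ℝ}
    (hf : Measurable f) (h0 : ∀ s ≤ 0, f s = 0) (h2 : ∫⁻ s, ‖f s‖ₑ ^ 2 ≠ ∞) (r : ℝ) :
    ∫⁻ s in Ioo 0 r, ‖frac (2 * b) f s‖ₑ ^ 2 ≤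
      kerE (1 + b) r * fracE b (fracE 1 (fun s => ‖frac b f s‖ₑ ^ 2)) r := by
  have h0' : ∀ s ≤ 0, ‖f s‖ₑ = 0 := fun s hs => by simp [h0 s hs]
  have hfin := setLIntegral_Ioo_sq_fracE_lt_top (by linarith : 0 < 2 * b)
    (f := fun s => ‖f s‖ₑ) (by fun_prop) h0' h2 r
  have hae := ae_lt_top (by fun_prop) hfin.ne
  rw [fracE_fracE hb one_pos (by fun_prop), add_comm b 1]
  refine le_trans (lintegral_mono_ae ?_)
    (setLIntegral_Ioo_sq_fracE_le hb (f := fun s => ‖frac b f s‖ₑ) (by fun_prop)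
      (fun s hs => by simp [frac_eq_zero h0 hs]) r)
  filter_upwards [hae] with s hs
  have : fracE (b + b) (fun s => ‖f s‖ₑ) s ≠ ∞ := by
    intro h
    rw [← two_mul] at h
    simp [h] at hs
  rw [two_mul, ← frac_frac hb hb hf this]
  exact pow_le_pow_left' (enorm_frac_le hb _ _) 2

/-- The integral equals I^{1-b} I^b f at r, and b < 1/2 makes ω_{1-b} square integrable near 0; the
constant is its squared L₂ norm over (0, r). -/
theorem enorm_setIntegral_sq_le {b : ℝ} (hb : 0 < b) (hb' : b < 1 / 2) {f : ℝ → ℝ}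
    (hf : Measurable f) (h0 : ∀ s ≤ 0, f s = 0) (h1 : ∫⁻ s, ‖f s‖ₑ ≠ ∞) {r : ℝ} (hr : 0 < r) :
    ‖∫ s in Ioo 0 r, f s‖ₑ ^ 2 ≤
      ENNReal.ofReal (r ^ (1 - 2 * b) / ((1 - 2 * b) * Real.Gamma (1 - b) ^ 2)) *
        ∫⁻ s in Ioo 0 r, ‖frac b f s‖ₑ ^ 2 := by
  have h0' : ∀ s ≤ 0, ‖f s‖ₑ = 0 := fun s hs => by simp [h0 s hs]
  have e1 : ∫ s in Ioo 0 r, f s = frac (1 - b + b) f r := by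
    rw [← integral_indicator measurableSet_Ioo, sub_add_cancel]
    refine integral_congr_ae (ae_of_all _ fun s => ?_)
    rcases le_or_gt s 0 with h | h
    · simp [h0 s h, h.not_gt]
    rcases lt_or_ge s r with h' | h'
    · simp [h, h', ker_of_pos (sub_pos.2 h')]
    · simp [h'.not_gt, ker_of_nonpos (sub_nonpos.2 h')]
  have hfin : fracE (1 - b + b) (fun s => ‖f s‖ₑ) r ≠ ∞ :=
    ((fracE_le (by linarith) (by fun_prop) h0' r).trans_lt
      (ENNReal.mul_lt_top (kerE_ne_top _ _).lt_top h1.lt_top)).ne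
  rw [e1, ← frac_frac (by linarith) hb hf hfin]
  have e2 : fracE (1 - b) (fun s => ‖frac b f s‖ₑ) r = ∫⁻ s, (kerE (1 - b) (r - s) * kerE 1 s) *
      (Ioo 0 r).indicator (fun s => ‖frac b f s‖ₑ) s := by
    refine lintegral_congr fun s => ?_
    rcases le_or_gt s 0 with h | h
    · simp [frac_eq_zero h0 h, h.not_gt]
    rcases lt_or_ge s r with h' | h'
    · rw [kerE_one_of_pos h, indicator_of_mem (mem_Ioo.2 ⟨h, h'⟩), mul_one]
    · simp [kerE_of_nonpos (sub_nonpos.2 h')]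
  have e3 : ∫⁻ s, (kerE (1 - b) (r - s) * kerE 1 s) ^ 2 =
      ENNReal.ofReal (r ^ (1 - 2 * b) / ((1 - 2 * b) * Real.Gamma (1 - b) ^ 2)) := by
    have hh := ofReal_mul_kerE_two_mul (a := 1 - b) (by linarith) hr
    rw [show 2 * (1 - b) - 1 = 1 - 2 * b by ring] at hh
    rw [← hh, show 2 * (1 - b) = (2 * (1 - b) - 1) + 1 by ring]
    have h := lintegral_kerE_mul_kerE (by linarith : 0 < 2 * (1 - b) - 1) one_pos r 0
    rw [sub_zero] at h
    rw [← h, ← lintegral_const_mul _ (by fun_prop)]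
    refine lintegral_congr fun s => ?_
    rw [mul_pow, kerE_sq_eq (by linarith), sub_zero, show 2 * (1 - b) - 1 = 1 - 2 * b by ring]
    rcases le_or_gt s 0 with h | h
    · simp [kerE_of_nonpos h]
    · simp [kerE_one_of_pos h]
  have e4 : ∫⁻ s, (Ioo 0 r).indicator (fun s => ‖frac b f s‖ₑ) s ^ 2 =
      ∫⁻ s in Ioo 0 r, ‖frac b f s‖ₑ ^ 2 := by
    rw [← lintegral_indicator measurableSet_Ioo]
    refine lintegral_congr fun s => ?_
    by_cases h : s ∈ Ioo 0 r <;> simp [h]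
  calc _ ≤ fracE (1 - b) (fun s => ‖frac b f s‖ₑ) r ^ 2 :=
        pow_le_pow_left' (enorm_frac_le (by linarith) _ _) 2
    _ ≤ _ := by
        rw [e2, ← e3, ← e4]
        exact sq_lintegral_mul_le (by fun_prop)
          ((measurable_frac b hf).enorm.indicator measurableSet_Ioo)

/-! ### Mittag-Leffler series and fractional Gronwall inequality -/

theorem summable_mittagLeffler {b : ℝ} (hb : 0 < b) (z : ℝ) :
    Summable (fun n : ℕ => z ^ n / Real.Gamma (1 + n * b)) := by
  -- Keep only y > R in Euler's integral and use y^x ≥ R^x there: Γ(1+x) outgrows every exponential.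
  have hlow : ∀ R x : ℝ, 0 < R → 0 ≤ x → R ^ x * Real.exp (-R) ≤ Real.Gamma (1 + x) := by
    intro R x hR hx
    have hI := Real.GammaIntegral_convergent (by linarith : 0 < 1 + x)
    rw [Real.Gamma_eq_integral (by linarith), ← integral_exp_neg_Ioi R, ← integral_const_mul]
    calc ∫ y in Ioi R, R ^ x * Real.exp (-y)
        ≤ ∫ y in Ioi R, Real.exp (-y) * y ^ (1 + x - 1) := by
          refine setIntegral_mono_on ((integrableOn_exp_neg_Ioi R).const_mul _)
            (hI.mono_set (Ioi_subset_Ioi hR.le)) measurableSet_Ioi fun y hy => ?_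
          rw [mul_comm, add_sub_cancel_left]
          have := Real.rpow_le_rpow hR.le (le_of_lt hy) hx
          gcongr
      _ ≤ _ := by
          refine setIntegral_mono_set hI ?_ (Ioi_subset_Ioi hR.le).eventuallyLE
          refine (ae_restrict_iff' measurableSet_Ioi).2 (ae_of_all _ fun y hy => ?_)
          have : 0 < y := hy
          simp only [Pi.zero_apply]
          positivity
  -- With R^b = 2|z| + 1, the series is dominated by a geometric series of ratio 1/2.
  set R : ℝ := (2 * |z| + 1) ^ b⁻¹ with hR
  have hz : 0 < 2 * |z| + 1 := by positivity
  have hR0 : 0 < R := by positivity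
  have hRb : R ^ b = 2 * |z| + 1 := by
    rw [hR, ← Real.rpow_mul hz.le, inv_mul_cancel₀ hb.ne', Real.rpow_one]
  refine Summable.of_norm_bounded (g := fun n : ℕ => Real.exp R * (1 / 2 : ℝ) ^ n)
    ((summable_geometric_of_lt_one (by norm_num) (by norm_num)).mul_left _) fun n => ?_
  have hG := hlow R (n * b) hR0 (by positivity)
  have hGp := Real.Gamma_pos_of_pos (by positivity : 0 < 1 + n * b)
  rw [mul_comm (n : ℝ) b, Real.rpow_mul hR0.le, hRb, Real.rpow_natCast, mul_comm b] at hG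
  rw [norm_div, norm_pow, Real.norm_eq_abs, Real.norm_of_nonneg hGp.le, div_le_iff₀ hGp]
  calc |z| ^ n ≤ ((1 / 2) * (2 * |z| + 1)) ^ n := by gcongr; linarith
    _ = Real.exp R * (1 / 2) ^ n * ((2 * |z| + 1) ^ n * Real.exp (-R)) := by
        rw [mul_pow, Real.exp_neg]; field_simp
    _ ≤ _ := by gcongr

/-- A Gronwall inequality for fractional integrals. -/
theorem gronwall_partial {b : ℝ} (hb : 0 < b) {Y : ℝ → ℝ≥0∞} {a k M : ℝ≥0∞} {R : ℝ}
    (hY0 : ∀ s ≤ 0, Y s = 0) (hYM : ∀ s ≤ R, Y s ≤ M)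
    (hY : ∀ s, 0 < s → s ≤ R → Y s ≤ a + k * fracE b Y s) (n : ℕ) :
    ∀ s ≤ R, Y s ≤ a * ∑ j ∈ Finset.range n, k ^ j * kerE (1 + j * b) s
      + M * (k ^ n * kerE (1 + n * b) s) := by
  induction n with
  | zero =>
    intro s hs
    rcases le_or_gt s 0 with h | h
    · simp [hY0 s h]
    · simpa [kerE_one_of_pos h] using hYM s hs
  | succ n ih =>
    intro s hs
    rcases le_or_gt s 0 with h | h
    · simp [hY0 s h]
    have hpos : ∀ j : ℕ, 0 < 1 + (j : ℝ) * b := fun j => by positivity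
    have hstep : ∀ j : ℕ, b + (1 + (j : ℝ) * b) = 1 + ((j + 1 : ℕ) : ℝ) * b := fun j => by
      push_cast; ring
    -- Applying I^b to the inductive bound raises the order of each kernel by b, because I^b
    -- ω_{1+jb} = ω_{1+(j+1)b}.
    have hfr : fracE b Y s ≤ a * ∑ j ∈ Finset.range n, k ^ j * kerE (1 + (j + 1 : ℕ) * b) s
        + M * (k ^ n * kerE (1 + (n + 1 : ℕ) * b) s) := by
      refine (fracE_mono b fun q hq => ih q (hq.le.trans hs)).trans_eq ?_
      rw [fracE_add _ (by fun_prop), fracE_const_mul _ _ (by fun_prop),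
        fracE_const_mul _ _ (by fun_prop), fracE_const_mul _ _ (by fun_prop),
        fracE_kerE hb (hpos n), hstep]
      congr 2
      unfold fracE
      simp_rw [Finset.mul_sum]
      rw [lintegral_finsetSum _ (fun j _ => by fun_prop)]
      refine Finset.sum_congr rfl fun j _ => ?_
      have := fracE_const_mul b (k ^ j) (f := kerE (1 + j * b)) (by fun_prop) s
      rw [fracE_kerE hb (hpos j), hstep] at this
      exact this
    calc Y s ≤ a + k * fracE b Y s := hY s h hs
      _ ≤ a + k * (a * ∑ j ∈ Finset.range n, k ^ j * kerE (1 + (j + 1 : ℕ) * b) s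
          + M * (k ^ n * kerE (1 + (n + 1 : ℕ) * b) s)) := by gcongr
      _ = _ := by
        have e : ∑ j ∈ Finset.range n, k ^ (j + 1) * kerE (1 + (j + 1 : ℕ) * b) s =
            k * ∑ j ∈ Finset.range n, k ^ j * kerE (1 + (j + 1 : ℕ) * b) s := by
          rw [Finset.mul_sum]
          exact Finset.sum_congr rfl fun j _ => by ring
        rw [Finset.sum_range_succ', e]
        simp only [Nat.cast_zero, zero_mul, add_zero, pow_zero, kerE_one_of_pos h, mul_one]
        ring

/-- Let the number of iterations tend to infinity. The remainder is M times a general term of the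
convergent Mittag-Leffler series, so it vanishes when M is finite. -/
theorem le_mul_mittagLeffler {b : ℝ} (hb : 0 < b) {Y : ℝ → ℝ≥0∞} {a M : ℝ≥0∞} {k R : ℝ}
    (hk : 0 ≤ k) (hR : 0 < R) (hM : M ≠ ∞)
    (hY0 : ∀ s ≤ 0, Y s = 0) (hYM : ∀ s ≤ R, Y s ≤ M)
    (hY : ∀ s, 0 < s → s ≤ R → Y s ≤ a + ENNReal.ofReal k * fracE b Y s) :
    Y R ≤ a * ENNReal.ofReal (mittagLeffler b (k * R ^ b)) := by
  have hpos : ∀ j : ℕ, 0 < Real.Gamma (1 + j * b) := fun j =>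
    Real.Gamma_pos_of_pos (by positivity)
  have hterm : ∀ j : ℕ, ENNReal.ofReal k ^ j * kerE (1 + j * b) R =
      ENNReal.ofReal ((k * R ^ b) ^ j / Real.Gamma (1 + j * b)) := fun j => by
    rw [kerE, ker_of_pos hR, ← ENNReal.ofReal_pow hk, ← ENNReal.ofReal_mul (by positivity),
      mul_pow, ← Real.rpow_natCast (R ^ b), ← Real.rpow_mul hR.le, mul_comm b,
      add_sub_cancel_left]
    congr 1
    ring
  have hs := summable_mittagLeffler hb (k * R ^ b)
  have hnn : ∀ j : ℕ, 0 ≤ (k * R ^ b) ^ j / Real.Gamma (1 + j * b) := fun j => by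
    have := hpos j
    positivity
  have hle : ∀ n : ℕ, Y R ≤ a * ENNReal.ofReal (mittagLeffler b (k * R ^ b)) +
      M * ENNReal.ofReal ((k * R ^ b) ^ n / Real.Gamma (1 + n * b)) := fun n => by
    refine (gronwall_partial hb hY0 hYM hY n R le_rfl).trans ?_
    simp_rw [hterm]
    gcongr
    rw [← ENNReal.ofReal_sum_of_nonneg (fun j _ => hnn j)]
    exact ENNReal.ofReal_le_ofReal (hs.sum_le_tsum _ (fun j _ => hnn j))
  have hlim : Filter.Tendsto (fun n : ℕ => a * ENNReal.ofReal (mittagLeffler b (k * R ^ b)) +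
      M * ENNReal.ofReal ((k * R ^ b) ^ n / Real.Gamma (1 + n * b))) Filter.atTop
      (nhds (a * ENNReal.ofReal (mittagLeffler b (k * R ^ b)) + M * ENNReal.ofReal 0)) := by
    refine Filter.Tendsto.add tendsto_const_nhds (ENNReal.Tendsto.const_mul ?_ (Or.inr hM))
    exact (ENNReal.continuous_ofReal.tendsto 0).comp hs.tendsto_atTop_zero
  have := ge_of_tendsto' hlim hle
  simpa using this

theorem mittagLeffler_pos {b z : ℝ} (hb : 0 < b) (hz : 0 ≤ z) : 0 < mittagLeffler b z := by
  have hnn : ∀ j : ℕ, 0 ≤ z ^ j / Real.Gamma (1 + j * b) := fun j => by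
    have := Real.Gamma_pos_of_pos (by positivity : 0 < 1 + j * b)
    positivity
  refine (summable_mittagLeffler hb z).tsum_pos hnn 0 ?_
  simp

/-! ### Numerical bounds behind the explicit constants -/

theorem one_le_Gamma {x : ℝ} (hx : 0 < x) (hx1 : x ≤ 1) : 1 ≤ Real.Gamma x := by
  have := Real.Gamma_strictAntiOn_Ioc.antitoneOn (⟨hx, hx1⟩ : x ∈ Ioc 0 1)
    (⟨one_pos, le_rfl⟩ : (1 : ℝ) ∈ Ioc 0 1) hx1
  rwa [Real.Gamma_one] at this

/-- By convexity, the slope of Γ from x to 3/2 is at most the slope from 3/2 to 2, which is small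
since Γ(3/2) = √π/2 is close to 1. With x = 1 + α/2 this produces the factor 5/8 = ½ · 5/4. -/
theorem four_fifths_le_Gamma {x : ℝ} (hx : 5 / 4 ≤ x) (hx1 : x < 3 / 2) :
    4 / 5 ≤ Real.Gamma x := by
  have h1 : Real.Gamma (3 / 2) = √Real.pi / 2 := by
    rw [show (3 / 2 : ℝ) = 1 / 2 + 1 by norm_num, Real.Gamma_add_one (by norm_num),
      Real.Gamma_one_half_eq]
    ring
  have h2 : 1.77 ≤ √Real.pi := Real.le_sqrt_of_sq_le (by
    have := Real.pi_gt_d2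
    norm_num at this ⊢
    linarith)
  have hc := Real.convexOn_Gamma.slope_mono_adjacent (x := x) (y := 3 / 2) (z := 2)
    (by simp; linarith) (by simp) hx1 (by norm_num)
  rw [Real.Gamma_two, div_le_div_iff₀ (by linarith) (by norm_num), h1] at hc
  norm_num at h2
  nlinarith

/-- Jordan's inequality sin y ≥ 2y/π at the complementary angle. It replaces the coercivity constant
by 1 - α. -/
theorem one_sub_le_cos {a : ℝ} (ha : 0 ≤ a) (ha1 : a ≤ 1) :
    1 - a ≤ Real.cos (Real.pi * (a / 2)) := by
  have hpi := Real.pi_pos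
  have h := Real.mul_le_sin (x := Real.pi / 2 - Real.pi * (a / 2)) (by nlinarith) (by nlinarith)
  rw [Real.sin_pi_div_two_sub] at h
  refine le_trans (le_of_eq ?_) h
  field_simp

/-! ### The finite element space -/

/-- `feSpace` as a linear subspace. -/
def feSubmodule (L : ℝ) {P : ℕ} (node : Fin (P + 1) → ℝ) : Submodule ℝ (ℝ → ℝ) where
  carrier := feSpace L node
  zero_mem' := ⟨continuous_const, fun _ => ⟨0, 0, by simp⟩, fun _ _ => rfl⟩
  add_mem' := by
    rintro v w ⟨hv, hva, hv0⟩ ⟨hw, hwa, hw0⟩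
    refine ⟨hv.add hw, fun p => ?_, fun x hx => by simp [hv0 x hx, hw0 x hx]⟩
    obtain ⟨a, b, h⟩ := hva p
    obtain ⟨a', b', h'⟩ := hwa p
    exact ⟨a + a', b + b', fun x hx => by simp [h x hx, h' x hx]; ring⟩
  smul_mem' := by
    rintro c v ⟨hv, hva, hv0⟩
    refine ⟨hv.const_smul c, fun p => ?_, fun x hx => by simp [hv0 x hx]⟩
    obtain ⟨a, b, h⟩ := hva p
    exact ⟨c * a, c * b, fun x hx => by simp [h x hx]; ring⟩

variable {L : ℝ} {P : ℕ} {node : Fin (P + 1) → ℝ}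

theorem exists_mem_Ioo_node (hnode0 : node 0 = 0) (hnodeL : node (Fin.last P) = L) {x : ℝ}
    (hx : x ∈ Ioo 0 L) (hxn : ∀ p, x ≠ node p) :
    ∃ p : Fin P, x ∈ Ioo (node p.castSucc) (node p.succ) := by
  by_contra! h
  have : ∀ p : Fin (P + 1), node p < x := by
    intro p
    induction p using Fin.induction with
    | zero => rw [hnode0]; exact hx.1
    | succ i ih =>
      have := h i
      rcases lt_trichotomy x (node i.succ) with h1 | h1 | h1
      · exact absurd ⟨ih, h1⟩ this
      · exact absurd h1 (hxn _)
      · exact h1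
  have := this (Fin.last P)
  rw [hnodeL] at this
  exact absurd hx.2 this.not_gt

theorem eq_zero_of_forall_node_eq_zero (hnode : StrictMono node) (hnode0 : node 0 = 0)
    (hnodeL : node (Fin.last P) = L) {v : ℝ → ℝ} (hv : v ∈ feSpace L node)
    (h : ∀ p, v (node p) = 0) : v = 0 := by
  funext x
  by_cases hx : x ∈ Ioo 0 L
  · by_cases hxn : ∀ p, x ≠ node p
    · obtain ⟨p, hp⟩ := exists_mem_Ioo_node hnode0 hnodeL hx hxn
      obtain ⟨a, b, hab⟩ := hv.2.1 p
      have hlt : node p.castSucc < node p.succ := hnode Fin.castSucc_lt_succ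
      have h1 := hab _ (left_mem_Icc.2 hlt.le)
      have h2 := hab _ (right_mem_Icc.2 hlt.le)
      rw [h] at h1 h2
      have ha : a = 0 := by
        have : a * (node p.succ - node p.castSucc) = 0 := by linarith
        exact (mul_eq_zero.1 this).resolve_right (sub_pos.2 hlt).ne'
      rw [hab x (Ioo_subset_Icc_self hp), ha]
      rw [ha] at h1
      simpa using h1.symm
    · push Not at hxn
      obtain ⟨p, rfl⟩ := hxn
      exact h p
  · exact hv.2.2 x hx

theorem ae_ne_node (node : Fin (P + 1) → ℝ) : ∀ᵐ x, ∀ p, x ≠ node p := by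
  rw [ae_all_iff]
  intro p
  simp [ae_iff]

theorem exists_bound_of_mem_feSpace (hnode0 : node 0 = 0)
    (hnodeL : node (Fin.last P) = L) {v : ℝ → ℝ} (hv : v ∈ feSpace L node) :
    (∃ K, ∀ x, |v x| ≤ K) ∧ (∃ K, 0 ≤ K ∧ ∀ᵐ x ∂(volOn L), |deriv v x| ≤ K) ∧
      ∀ x ∈ Ioo 0 L, (∀ p, x ≠ node p) → DifferentiableAt ℝ v x := by
  have hd : ∀ p : Fin P, ∃ a, ∀ x ∈ Ioo (node p.castSucc) (node p.succ), HasDerivAt v a x := by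
    intro p
    obtain ⟨a, b, hab⟩ := hv.2.1 p
    refine ⟨a, fun x hx => ?_⟩
    have h1 : HasDerivAt (fun x => a * x + b) a x := by
      simpa using ((hasDerivAt_id x).const_mul a).add_const b
    refine h1.congr_of_eventuallyEq ?_
    filter_upwards [Ioo_mem_nhds hx.1 hx.2] with y hy
    exact hab y (Ioo_subset_Icc_self hy)
  choose a ha using hd
  refine ⟨?_, ⟨∑ p, |a p|, by positivity, ?_⟩, ?_⟩
  · obtain ⟨K, hK⟩ := (isCompact_Icc (a := (0 : ℝ)) (b := L)).exists_bound_of_continuousOn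
      hv.1.continuousOn
    refine ⟨max K 0, fun x => ?_⟩
    by_cases hx : x ∈ Ioo 0 L
    · exact (hK x (Ioo_subset_Icc_self hx)).trans (le_max_left _ _)
    · rw [hv.2.2 x hx]; simp
  · unfold volOn
    rw [ae_restrict_iff' measurableSet_Ioo]
    filter_upwards [ae_ne_node node] with x hxn hx
    obtain ⟨p, hp⟩ := exists_mem_Ioo_node hnode0 hnodeL hx hxn
    rw [(ha p x hp).deriv]
    exact Finset.single_le_sum (f := fun p => |a p|) (fun _ _ => abs_nonneg _) (Finset.mem_univ p)
  · intro x hx hxn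
    obtain ⟨p, hp⟩ := exists_mem_Ioo_node hnode0 hnodeL hx hxn
    exact (ha p x hp).differentiableAt

theorem ip_eq_integral (hL : 0 < L) (v w : ℝ → ℝ) : ip L v w = ∫ x, v x * w x ∂(volOn L) := by
  unfold ip volOn
  rw [intervalIntegral.integral_of_le hL.le, integral_Ioc_eq_integral_Ioo]

theorem ip_self_eq_zero (hL : 0 < L) {v : ℝ → ℝ} (hv : v ∈ feSpace L node)
    (h : ip L v v = 0) : v = 0 := by
  have hc : Continuous fun x => v x * v x := hv.1.mul hv.1
  funext x
  by_cases hx : x ∈ Ioo 0 L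
  · by_contra hne
    have : 0 < ip L v v := by
      refine intervalIntegral.integral_pos hL hc.continuousOn (fun y _ => mul_self_nonneg _)
        ⟨x, Ioo_subset_Icc_self hx, ?_⟩
      exact mul_self_pos.2 hne
    exact this.ne' h
  · exact hv.2.2 x hx

/-- The finite element space has an `L₂`-orthonormal basis whose coordinates are linear in the
nodal values. -/
theorem exists_orthonormal_basis (hL : 0 < L) (hnode : StrictMono node) (hnode0 : node 0 = 0)
    (hnodeL : node (Fin.last P) = L) :
    ∃ (n : ℕ) (b : Fin n → ℝ → ℝ) (m : Fin n → Fin (P + 1) → ℝ),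
      (∀ i, b i ∈ feSpace L node) ∧ (∀ i j, ip L (b i) (b j) = if i = j then 1 else 0) ∧
      ∀ v ∈ feSpace L node, ∀ x, v x = ∑ i, (∑ p, m i p * v (node p)) * b i x := by
  let V := feSubmodule L node
  let ev : V →ₗ[ℝ] (Fin (P + 1) → ℝ) :=
    { toFun := fun v p => v.1 (node p)
      map_add' := fun _ _ => rfl
      map_smul' := fun _ _ => rfl }
  have hev : Function.Injective ev := by
    rw [← LinearMap.ker_eq_bot, LinearMap.ker_eq_bot']
    intro v hv
    ext1
    exact eq_zero_of_forall_node_eq_zero hnode hnode0 hnodeL v.2 fun p => congrFun hv p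
  have hfd : FiniteDimensional ℝ V := FiniteDimensional.of_injective ev hev
  -- A left inverse of nodal evaluation expresses every coordinate as a fixed linear form in nodal
  -- values, so absolute continuity in time passes from nodal values to coordinates.
  obtain ⟨lv, hlv⟩ := ev.exists_leftInverse_of_injective (LinearMap.ker_eq_bot.2 hev)
  have hint : ∀ v w : V, IntervalIntegrable (fun x => v.1 x * w.1 x) volume 0 L := fun v w =>
    (v.2.1.mul w.2.1).intervalIntegrable _ _
  let core : InnerProductSpace.Core ℝ V :=
    { inner := fun v w => ip L v.1 w.1
      conj_inner_symm := fun v w => by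
        simp only [ip, conj_trivial]
        simp_rw [mul_comm]
      re_inner_nonneg := fun v => by
        simp only [ip, RCLike.re_to_real]
        exact intervalIntegral.integral_nonneg hL.le fun x _ => mul_self_nonneg _
      add_left := fun u v w => by
        simp only [ip, Submodule.coe_add, Pi.add_apply, add_mul]
        exact intervalIntegral.integral_add (hint u w) (hint v w)
      smul_left := fun u v r => by
        simp only [ip, Submodule.coe_smul, Pi.smul_apply, smul_eq_mul, mul_assoc, conj_trivial]
        exact intervalIntegral.integral_const_mul _ _
      definite := fun v hv => by
        ext1
        exact ip_self_eq_zero hL v.2 hv }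
  let _ : NormedAddCommGroup V := core.toNormedAddCommGroup
  let _ : InnerProductSpace ℝ V := InnerProductSpace.ofCore core.toCore
  let B := stdOrthonormalBasis ℝ V
  refine ⟨_, fun i => (B i).1, fun i p => inner ℝ (B i) (lv (Pi.single p 1)),
    fun i => (B i).2, fun i j => ?_, fun v hv x => ?_⟩
  · exact (orthonormal_iff_ite.1 B.orthonormal) i j
  · let w : V := ⟨v, hv⟩
    have h1 : ∀ i, ∑ p, inner ℝ (B i) (lv (Pi.single p 1)) * v (node p) = inner ℝ (B i) w := by
      intro i
      have h2 : w = ∑ p, v (node p) • lv (Pi.single p 1) := by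
        calc w = lv (ev w) := (LinearMap.congr_fun hlv w).symm
          _ = lv (∑ p, v (node p) • Pi.single p 1) := by
            congr 1
            ext q
            simp [ev, w, Finset.sum_apply, Pi.single_apply]
          _ = _ := by simp
      rw [h2, inner_sum]
      refine Finset.sum_congr rfl fun p _ => ?_
      rw [inner_smul_right, mul_comm]
    simp_rw [h1]
    have h3 := congrArg Subtype.val (B.sum_repr' w)
    have h4 := congrFun h3 x
    rw [← show w.1 x = v x from rfl, ← h4]
    simp [Finset.sum_apply]

/-! ### Fractional derivatives of absolutely continuous functions -/

theorem frac_ker {a b : ℝ} (ha : 0 < a) (hb : 0 < b) (r : ℝ) :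
    frac a (ker b) r = ker (a + b) r := by
  unfold frac
  rw [integral_eq_lintegral_of_nonneg_ae
    (ae_of_all _ fun s => mul_nonneg (ker_nonneg ha _) (ker_nonneg hb _))
    (Measurable.aestronglyMeasurable (by fun_prop))]
  simp_rw [ENNReal.ofReal_mul (ker_nonneg ha _)]
  rw [show ker (a + b) r = (kerE (a + b) r).toReal from
    (ENNReal.toReal_ofReal (ker_nonneg (add_pos ha hb) _)).symm, ← fracE_kerE ha hb]
  rfl

theorem integrable_ker_mul {a : ℝ} (ha : 0 < a) {f : ℝ → ℝ} (hf : Measurable f) {r : ℝ}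
    (hfin : fracE a (fun s => ‖f s‖ₑ) r ≠ ∞) : Integrable fun s => ker a (r - s) * f s := by
  refine ⟨Measurable.aestronglyMeasurable (by fun_prop), ?_⟩
  rw [HasFiniteIntegral]
  simp_rw [enorm_mul, enorm_ker ha]
  exact hfin.lt_top

theorem frac_add {a : ℝ} (ha : 0 < a) {f g : ℝ → ℝ} (hf : Measurable f) (hg : Measurable g) {r : ℝ}
    (hfin : fracE a (fun s => ‖f s‖ₑ) r ≠ ∞) (hgin : fracE a (fun s => ‖g s‖ₑ) r ≠ ∞) :
    frac a (fun s => f s + g s) r = frac a f r + frac a g r := by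
  unfold frac
  simp_rw [mul_add]
  exact integral_add (integrable_ker_mul ha hf hfin) (integrable_ker_mul ha hg hgin)

theorem frac_const_mul (a c : ℝ) (f : ℝ → ℝ) (r : ℝ) :
    frac a (fun s => c * f s) r = c * frac a f r := by
  unfold frac
  rw [← integral_const_mul]
  simp_rw [mul_left_comm]

theorem frac_one_eq {f : ℝ → ℝ} (h0 : ∀ s ≤ 0, f s = 0) (r : ℝ) :
    frac 1 f r = ∫ s in Ioo 0 r, f s := by
  rw [← integral_indicator measurableSet_Ioo]
  refine integral_congr_ae (ae_of_all _ fun s => ?_)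
  rcases le_or_gt s 0 with h | h
  · simp [h0 s h, h.not_gt]
  rcases lt_or_ge s r with h' | h'
  · simp [h, h', ker_of_pos (sub_pos.2 h')]
  · simp [h'.not_gt, ker_of_nonpos (sub_nonpos.2 h')]

theorem fracE_enorm_lt_top {β : ℝ} (hβ : 1 ≤ β) {f : ℝ → ℝ} (hf : Measurable f)
    (h0 : ∀ s ≤ 0, f s = 0) (h1 : ∫⁻ s, ‖f s‖ₑ ≠ ∞) (r : ℝ) :
    fracE β (fun s => ‖f s‖ₑ) r ≠ ∞ :=
  ((fracE_le hβ (by fun_prop) (fun s hs => by simp [h0 s hs]) r).trans_lt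
    (ENNReal.mul_lt_top (kerE_ne_top _ _).lt_top h1.lt_top)).ne

/-- The time derivative of an absolutely continuous function, cut off at time `t`. -/
noncomputable def cutDeriv (t : ℝ) (c : ℝ → ℝ) : ℝ → ℝ := (Ioo 0 t).indicator (deriv c)

@[fun_prop]
theorem measurable_cutDeriv (t : ℝ) (c : ℝ → ℝ) : Measurable (cutDeriv t c) :=
  (measurable_deriv c).indicator measurableSet_Ioo

theorem cutDeriv_of_nonpos {t : ℝ} {c : ℝ → ℝ} (s : ℝ) (hs : s ≤ 0) : cutDeriv t c s = 0 := by
  simp [cutDeriv, hs.not_gt]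

theorem lintegral_enorm_cutDeriv {t : ℝ} (ht : 0 ≤ t) {c : ℝ → ℝ}
    (hc : AbsolutelyContinuousOnInterval c 0 t) : ∫⁻ s, ‖cutDeriv t c s‖ₑ ≠ ∞ := by
  have h := hc.intervalIntegrable_deriv
  rw [intervalIntegrable_iff_integrableOn_Ioo_of_le ht] at h
  exact ((integrable_indicator_iff measurableSet_Ioo).2 h).2.ne

theorem integral_cutDeriv {t : ℝ} {c : ℝ → ℝ}
    (hc : AbsolutelyContinuousOnInterval c 0 t) {r : ℝ} (hr : 0 ≤ r) (hrt : r ≤ t) :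
    ∫ s in Ioo 0 r, cutDeriv t c s = c r - c 0 := by
  have h := (hc.mono (c := 0) (d := r) (by
    rw [uIcc_of_le hr, uIcc_of_le (hr.trans hrt)]; exact Icc_subset_Icc_right hrt)).integral_deriv_eq_sub
  rw [intervalIntegral.integral_of_le hr, integral_Ioc_eq_integral_Ioo] at h
  rw [← h]
  refine setIntegral_congr_fun measurableSet_Ioo fun s hs => ?_
  rw [cutDeriv, indicator_of_mem (mem_Ioo.2 ⟨hs.1, hs.2.trans_le hrt⟩)]

/-- Write c = c(0) ω₁ + I¹c' and commute I^α with I¹. This exhibits I^α c as an ordinary primitive,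
whose derivative can be read off almost everywhere. -/
theorem fracIntegral_eq_frac_one {α t : ℝ} (hα : 0 < α) {c : ℝ → ℝ}
    (hc : AbsolutelyContinuousOnInterval c 0 t) {r : ℝ} (hr : 0 ≤ r) (hrt : r ≤ t) :
    fracIntegral α c r = ∫ s in (0 : ℝ)..r, (c 0 * ker α s + frac α (cutDeriv t c) s) := by
  set φ := cutDeriv t c with hφ
  have hφm : Measurable φ := measurable_cutDeriv t c
  have hφ0 : ∀ s ≤ 0, φ s = 0 := cutDeriv_of_nonpos
  have hφ1 : ∫⁻ s, ‖φ s‖ₑ ≠ ∞ := lintegral_enorm_cutDeriv (hr.trans hrt) hc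
  have hfin : ∀ β, 1 ≤ β → fracE β (fun s => ‖φ s‖ₑ) r ≠ ∞ := fun β hβ =>
    fracE_enorm_lt_top hβ hφm hφ0 hφ1 r
  have hker : ∀ a b, 0 < a → 0 < b → fracE a (fun s => ‖c 0 * ker b s‖ₑ) r ≠ ∞ := by
    intro a b ha hb
    simp_rw [enorm_mul, enorm_ker hb]
    rw [fracE_const_mul _ _ (by fun_prop), fracE_kerE ha hb]
    exact ENNReal.mul_ne_top (by simp) (kerE_ne_top _ _)
  have hfr : ∀ a b, 0 < a → 0 < b → 1 ≤ a + b →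
      fracE a (fun s => ‖frac b φ s‖ₑ) r ≠ ∞ := by
    intro a b ha hb hab
    refine ne_top_of_le_ne_top (hfin (a + b) hab) ?_
    rw [← fracE_fracE ha hb (by fun_prop)]
    exact fracE_mono a fun s _ => enorm_frac_le hb φ s
  have e1 : fracIntegral α c r = frac α (fun s => c 0 * ker 1 s + frac 1 φ s) r := by
    unfold fracIntegral frac
    rw [intervalIntegral.integral_of_le hr, integral_Ioc_eq_integral_Ioo,
      ← integral_indicator measurableSet_Ioo]
    refine integral_congr_ae (ae_of_all _ fun s => ?_)
    rcases le_or_gt s 0 with h | h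
    · have : frac 1 φ s = 0 := frac_eq_zero hφ0 h
      unfold frac at this
      simp [h.not_gt, ker_of_nonpos h, this]
    rcases lt_or_ge s r with h' | h'
    · have h2 : frac 1 φ s = c s - c 0 := by
        rw [frac_one_eq hφ0, hφ, integral_cutDeriv hc h.le (h'.le.trans hrt)]
      unfold frac at h2
      simp only [h2]
      rw [indicator_of_mem (mem_Ioo.2 ⟨h, h'⟩), ker_of_pos h, ker, if_pos (sub_pos.2 h')]
      simp
    · simp [h'.not_gt, ker_of_nonpos (sub_nonpos.2 h')]
  have e2 : ∫ s in (0 : ℝ)..r, (c 0 * ker α s + frac α φ s)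
      = frac 1 (fun s => c 0 * ker α s + frac α φ s) r := by
    rw [frac_one_eq (fun s hs => by simp [ker_of_nonpos hs, frac_eq_zero hφ0 hs]),
      intervalIntegral.integral_of_le hr, integral_Ioc_eq_integral_Ioo]
  rw [e1, e2, frac_add hα (by fun_prop) (by fun_prop) (hker _ _ hα one_pos)
      (hfr _ _ hα one_pos (by linarith)),
    frac_add one_pos (by fun_prop) (by fun_prop) (hker _ _ one_pos hα)
      (hfr _ _ one_pos hα (by linarith)), frac_const_mul, frac_const_mul, frac_ker hα one_pos,
    frac_ker one_pos hα, frac_frac hα one_pos hφm (hfin _ (by linarith)),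
    frac_frac one_pos hα hφm (hfin _ (by linarith)), add_comm α 1]

theorem intervalIntegrable_ker_add_frac {α t : ℝ} (hα : 0 < α) (ht : 0 ≤ t) {c : ℝ → ℝ}
    (hc : AbsolutelyContinuousOnInterval c 0 t) :
    IntervalIntegrable (fun s => c 0 * ker α s + frac α (cutDeriv t c) s) volume 0 t := by
  rw [intervalIntegrable_iff_integrableOn_Ioo_of_le ht]
  have hφ0 : ∀ s ≤ 0, cutDeriv t c s = 0 := cutDeriv_of_nonpos
  refine Integrable.add (Integrable.const_mul ⟨(measurable_ker α).aestronglyMeasurable, ?_⟩ _)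
    ⟨(measurable_frac α (measurable_cutDeriv t c)).aestronglyMeasurable, ?_⟩
  · rw [HasFiniteIntegral]
    simp_rw [enorm_ker hα]
    rw [setLIntegral_Ioo_eq_fracE (fun s hs => kerE_of_nonpos hs), fracE_kerE one_pos hα]
    exact (kerE_ne_top _ _).lt_top
  · rw [HasFiniteIntegral, setLIntegral_Ioo_eq_fracE
      (fun s hs => by simp [frac_eq_zero hφ0 hs])]
    refine (fracE_mono 1 fun s _ => enorm_frac_le hα (cutDeriv t c) s).trans_lt ?_
    rw [fracE_fracE one_pos hα (by fun_prop)]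
    exact (fracE_enorm_lt_top (by linarith) (measurable_cutDeriv t c) hφ0
      (lintegral_enorm_cutDeriv ht hc) t).lt_top

/-- The fractional derivative of an absolutely continuous function. -/
theorem ae_hasDerivAt_fracIntegral {α t : ℝ} (hα : 0 < α) (ht : 0 ≤ t) {c : ℝ → ℝ}
    (hc : AbsolutelyContinuousOnInterval c 0 t) :
    ∀ᵐ s, s ∈ Ioo 0 t → HasDerivAt c (cutDeriv t c s) s ∧
      HasDerivAt (fracIntegral α c) (c 0 * ker α s + frac α (cutDeriv t c) s) s := by
  filter_upwards [hc.ae_differentiableAt,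
    (intervalIntegrable_ker_add_frac hα ht hc).ae_hasDerivAt_integral] with s h1 h2 hs
  have hs' : s ∈ uIcc 0 t := by rw [uIcc_of_le ht]; exact Ioo_subset_Icc_self hs
  refine ⟨?_, ?_⟩
  · rw [cutDeriv, indicator_of_mem hs]
    exact (h1 hs').hasDerivAt
  · refine (h2 hs' 0 left_mem_uIcc).congr_of_eventuallyEq ?_
    filter_upwards [Ioo_mem_nhds hs.1 hs.2] with r hr
    exact fracIntegral_eq_frac_one hα hc hr.1.le hr.2.le

/-! ### Energy estimates in space -/

section Spatial

variable {X : Type*} [MeasurableSpace X] {μ : Measure X} {F : X → ℝ} {CF : ℝ}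

theorem memLp_bounded_mul (hF : AEStronglyMeasurable F μ) (hCF : ∀ᵐ x ∂μ, 1 + F x ^ 2 ≤ CF)
    {v : X → ℝ} (hv : MemLp v 2 μ) : MemLp (fun x => F x * v x) 2 μ := by
  refine hv.of_le_mul (c := CF) (hF.mul hv.1) ?_
  filter_upwards [hCF] with x hx
  rw [norm_mul]
  refine mul_le_mul_of_nonneg_right ?_ (norm_nonneg _)
  rw [Real.norm_eq_abs, abs_le]
  constructor <;> nlinarith [sq_nonneg (F x + 1), sq_nonneg (F x - 1)]

theorem integrable_mul_of_memLp_two {v w : X → ℝ} (hv : MemLp v 2 μ) (hw : MemLp w 2 μ) :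
    Integrable (fun x => v x * w x) μ := hv.integrable_mul hw

/-- The energy estimate in space. -/
theorem energy_estimate (hF : AEStronglyMeasurable F μ) (hCF : ∀ᵐ x ∂μ, 1 + F x ^ 2 ≤ CF)
    {g g' z v v' w w' : X → ℝ} (ω : ℝ) (hg : MemLp g 2 μ) (hg' : MemLp g' 2 μ)
    (hv : MemLp v 2 μ) (hv' : MemLp v' 2 μ) (hw : MemLp w 2 μ) (hw' : MemLp w' 2 μ)
    (h : ∫ x, z x * v x ∂μ + ∫ x, (ω * w' x + v' x) * v' x ∂μ
      - ∫ x, F x * (ω * w x + v x) * v' x ∂μ = ∫ x, g x * v x ∂μ + ∫ x, g' x * v' x ∂μ) :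
    ∫ x, z x * v x ∂μ ≤ CF / 2 * ∫ x, v x ^ 2 ∂μ + (1 / 2 * ∫ x, g x ^ 2 ∂μ + ∫ x, g' x ^ 2 ∂μ)
      + CF * ω ^ 2 * (∫ x, w x ^ 2 ∂μ + ∫ x, w' x ^ 2 ∂μ) := by
  have hy' : MemLp (fun x => ω * w' x + v' x) 2 μ := (hw'.const_mul ω).add hv'
  have hy : MemLp (fun x => F x * (ω * w x + v x)) 2 μ :=
    memLp_bounded_mul hF hCF ((hw.const_mul ω).add hv)
  have i1 := integrable_mul_of_memLp_two hg hv
  have i2 := integrable_mul_of_memLp_two hg' hv'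
  have i3 := integrable_mul_of_memLp_two hy' hv'
  have i4 := integrable_mul_of_memLp_two hy hv'
  have j1 := hv.integrable_sq.const_mul (CF / 2)
  have j2 := hg.integrable_sq.const_mul (1 / 2)
  have j3 := hg'.integrable_sq
  have j4 := hw.integrable_sq
  have j5 := hw'.integrable_sq
  have k : Integrable (fun x => g x * v x + g' x * v' x - (ω * w' x + v' x) * v' x) μ :=
    (i1.add i2).sub i3
  have e : ∫ x, z x * v x ∂μ = ∫ x, (g x * v x + g' x * v' x - (ω * w' x + v' x) * v' x
      + F x * (ω * w x + v x) * v' x) ∂μ := by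
    rw [integral_add k i4, integral_sub (i1.fun_add i2) i3, integral_add i1 i2]
    linarith
  rw [e, ← integral_add j4 j5, ← integral_const_mul, ← integral_const_mul, ← integral_const_mul,
    ← integral_add j2 j3, ← integral_add j1 (j2.fun_add j3),
    ← integral_add (j1.fun_add (j2.fun_add j3)) ((j4.fun_add j5).const_mul _)]
  refine integral_mono_ae (k.fun_add i4)
    ((j1.fun_add (j2.fun_add j3)).fun_add ((j4.fun_add j5).const_mul _)) ?_
  filter_upwards [hCF] with x hx
  -- Cauchy–Schwarz in ℝ² for the vectors (F, -1) and (w, w').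
  have h1 : ω ^ 2 * (F x * w x - w' x) ^ 2 ≤ CF * ω ^ 2 * (w x ^ 2 + w' x ^ 2) := by
    have : (F x * w x - w' x) ^ 2 ≤ (1 + F x ^ 2) * (w x ^ 2 + w' x ^ 2) := by
      nlinarith [sq_nonneg (F x * w' x + w x)]
    have h2 : (1 + F x ^ 2) * (w x ^ 2 + w' x ^ 2) ≤ CF * (w x ^ 2 + w' x ^ 2) := by gcongr
    calc _ ≤ ω ^ 2 * (CF * (w x ^ 2 + w' x ^ 2)) := by gcongr; linarith
      _ = _ := by ring
  have h3 : (1 + F x ^ 2) * v x ^ 2 ≤ CF * v x ^ 2 := by gcongr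
  -- The Young weights make the v'² contributions 1/4 + 1/2 + 1/4 cancel the full v'² exactly, while
  -- v² collects (1 + F²)/2 ≤ CF/2.
  nlinarith [sq_nonneg (g x - v x), sq_nonneg (g' x - v' x / 2), sq_nonneg (F x * v x - v' x),
    sq_nonneg (ω * (F x * w x - w' x) - v' x / 2)]

/-- The inverse estimate `∫ z'² ≤ C ∫ z²` turns the equation into a bound for the time derivative. -/
theorem derivative_estimate (hF : AEStronglyMeasurable F μ) (hCF : ∀ᵐ x ∂μ, 1 + F x ^ 2 ≤ CF)
    {g g' z z' y y' : X → ℝ} {C : ℝ} (hC : 0 ≤ C) (hg : MemLp g 2 μ) (hg' : MemLp g' 2 μ)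
    (hz : MemLp z 2 μ) (hz' : MemLp z' 2 μ) (hy : MemLp y 2 μ) (hy' : MemLp y' 2 μ)
    (hinv : ∫ x, z' x ^ 2 ∂μ ≤ C * ∫ x, z x ^ 2 ∂μ)
    (h : ∫ x, z x * z x ∂μ + ∫ x, y' x * z' x ∂μ - ∫ x, F x * y x * z' x ∂μ
      = ∫ x, g x * z x ∂μ + ∫ x, g' x * z' x ∂μ) :
    ∫ x, z x ^ 2 ∂μ ≤ 2 * ∫ x, g x ^ 2 ∂μ + 6 * (C + 1) * (∫ x, g' x ^ 2 ∂μ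
      + ∫ x, y' x ^ 2 ∂μ + CF * ∫ x, y x ^ 2 ∂μ) := by
  have hFy := memLp_bounded_mul hF hCF hy
  have i1 := integrable_mul_of_memLp_two hg hz
  have i2 := integrable_mul_of_memLp_two hg' hz'
  have i3 := integrable_mul_of_memLp_two hy' hz'
  have i4 := integrable_mul_of_memLp_two hFy hz'
  have j1 := hg.integrable_sq
  have j2 := hz.integrable_sq.const_mul (1 / 4)
  have j3 := hz'.integrable_sq.const_mul (1 / (4 * (C + 1)))
  have j4 := hg'.integrable_sq
  have j5 := hy'.integrable_sq
  have j6 := hy.integrable_sq.const_mul CF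
  have j7 := ((j4.fun_add j5).fun_add j6).const_mul (3 * (C + 1))
  have k : Integrable (fun x => g x * z x + g' x * z' x - y' x * z' x) μ := (i1.add i2).sub i3
  have e : ∫ x, z x ^ 2 ∂μ = ∫ x, (g x * z x + g' x * z' x - y' x * z' x
      + F x * y x * z' x) ∂μ := by
    rw [integral_add k i4, integral_sub (i1.fun_add i2) i3, integral_add i1 i2]
    simp_rw [sq]
    linarith
  have key : ∫ x, z x ^ 2 ∂μ ≤ ∫ x, g x ^ 2 ∂μ + 1 / 4 * ∫ x, z x ^ 2 ∂μ
      + 1 / (4 * (C + 1)) * ∫ x, z' x ^ 2 ∂μ + 3 * (C + 1) * (∫ x, g' x ^ 2 ∂μ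
      + ∫ x, y' x ^ 2 ∂μ + CF * ∫ x, y x ^ 2 ∂μ) := by
    have e2 : ∫ x, g x ^ 2 ∂μ + 1 / 4 * ∫ x, z x ^ 2 ∂μ
      + 1 / (4 * (C + 1)) * ∫ x, z' x ^ 2 ∂μ + 3 * (C + 1) * (∫ x, g' x ^ 2 ∂μ
      + ∫ x, y' x ^ 2 ∂μ + CF * ∫ x, y x ^ 2 ∂μ) = ∫ x, (g x ^ 2 + 1 / 4 * z x ^ 2
        + 1 / (4 * (C + 1)) * z' x ^ 2 + 3 * (C + 1) * (g' x ^ 2 + y' x ^ 2 + CF * y x ^ 2)) ∂μ := by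
      rw [integral_add ((j1.fun_add j2).fun_add j3) j7, integral_add (j1.fun_add j2) j3, integral_add j1 j2,
        integral_const_mul, integral_const_mul, integral_const_mul, integral_add (j4.fun_add j5) j6,
        integral_add j4 j5, integral_const_mul]
    rw [e2]
    conv_lhs => rw [e]
    refine integral_mono_ae (k.fun_add i4) (((j1.fun_add j2).fun_add j3).fun_add j7) ?_
    filter_upwards [hCF] with x hx
    -- Three products with z' each cost 1/(12(C+1)) of z'², hence 1/(4(C+1)) in total; by the
    -- inverse estimate this is at most a quarter of ∫ z². Using C + 1 avoids dividing by zero.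
    have hyoung : ∀ a : ℝ, a * z' x ≤ 1 / (12 * (C + 1)) * z' x ^ 2 + 3 * (C + 1) * a ^ 2 := by
      intro a
      have h1 : 0 < C + 1 := by linarith
      rw [← sub_nonneg]
      have : 1 / (12 * (C + 1)) * z' x ^ 2 + 3 * (C + 1) * a ^ 2 - a * z' x
        = (z' x - 6 * (C + 1) * a) ^ 2 / (12 * (C + 1)) := by field_simp; ring
      rw [this]; positivity
    have h1 := hyoung (g' x)
    have h2 := hyoung (-y' x)
    have h3 := hyoung (F x * y x)
    have h4 : (F x * y x) ^ 2 ≤ CF * y x ^ 2 := by rw [mul_pow]; gcongr; linarith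
    have h5 : 3 * (C + 1) * (F x * y x) ^ 2 ≤ 3 * (C + 1) * (CF * y x ^ 2) := by gcongr
    have h6 : 1 / (4 * (C + 1)) * z' x ^ 2 = 3 * (1 / (12 * (C + 1)) * z' x ^ 2) := by
      field_simp; ring
    rw [h6]
    nlinarith [sq_nonneg (g x - z x / 2)]
  have h7 : 1 / (4 * (C + 1)) * ∫ x, z' x ^ 2 ∂μ ≤ 1 / 4 * ∫ x, z x ^ 2 ∂μ := by
    have h0 : 0 ≤ ∫ x, z x ^ 2 ∂μ := integral_nonneg fun _ => sq_nonneg _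
    calc _ ≤ 1 / (4 * (C + 1)) * (C * ∫ x, z x ^ 2 ∂μ) := by gcongr
      _ ≤ 1 / (4 * (C + 1)) * ((C + 1) * ∫ x, z x ^ 2 ∂μ) := by gcongr; linarith
      _ = _ := by field_simp
  linarith

end Spatial

/-! ### The equation in coordinates -/

theorem sqNorm_eq_lintegral (L : ℝ) (v : ℝ → ℝ) : sqNorm L v = ∫⁻ x, ‖v x‖ₑ ^ 2 ∂(volOn L) := by
  unfold sqNorm
  rw [eLpNorm_eq_lintegral_rpow_enorm_toReal (by norm_num) (by norm_num)]
  simp only [ENNReal.toReal_ofNat, ENNReal.rpow_ofNat]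
  rw [← ENNReal.rpow_two, ← ENNReal.rpow_mul]
  norm_num

theorem sqNorm_eq_ofReal {L : ℝ} {v : ℝ → ℝ} (hv : MemLp v 2 (volOn L)) :
    sqNorm L v = ENNReal.ofReal (∫ x, v x ^ 2 ∂(volOn L)) := by
  rw [sqNorm_eq_lintegral, ofReal_integral_eq_lintegral_ofReal hv.integrable_sq
    (ae_of_all _ fun _ => sq_nonneg _)]
  refine lintegral_congr fun x => ?_
  rw [← sq_abs, ENNReal.ofReal_pow (abs_nonneg _), ← Real.enorm_eq_ofReal_abs]

theorem ae_memLp_of_memL1L2 {L T : ℝ} {g : ℝ → ℝ → ℝ} (hg : MemL1L2 L T g) :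
    ∀ᵐ t ∂(volOn T), MemLp (g t) 2 (volOn L) := by
  have : SFinite (volOn L) := by unfold volOn; infer_instance
  have : SFinite (volOn T) := by unfold volOn; infer_instance
  have h1 : AEMeasurable (fun t => eLpNorm (g t) 2 (volOn L)) (volOn T) := by
    have : (fun t => eLpNorm (g t) 2 (volOn L)) =
        fun t => (∫⁻ x, ‖g t x‖ₑ ^ 2 ∂(volOn L)) ^ (1 / 2 : ℝ) := by
      funext t
      rw [← sqNorm_eq_lintegral, sqNorm, ← ENNReal.rpow_two, ← ENNReal.rpow_mul]
      norm_num
    rw [this]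
    exact (AEMeasurable.lintegral_prod_right' (hg.1.enorm.pow_const 2)).pow_const _
  filter_upwards [hg.1.prodMk_left, ae_lt_top' h1 hg.2.ne] with t h2 h3
  exact ⟨h2, h3⟩

theorem intervalIntegrable_omega_mul {α t : ℝ} (hα : 0 < α) {c : ℝ → ℝ}
    (hc : ContinuousOn c (Icc 0 t)) {r : ℝ} (hr : 0 ≤ r) (hrt : r ≤ t) :
    IntervalIntegrable (fun s => omega α (r - s) * c s) volume 0 r := by
  have h1 : IntervalIntegrable (fun s : ℝ => omega α s) volume 0 r :=
    (intervalIntegral.intervalIntegrable_rpow' (by linarith)).div_const _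
  have h2 := h1.comp_sub_left r
  simp only [sub_zero, sub_self] at h2
  refine h2.symm.mul_continuousOn ?_
  rw [uIcc_of_le hr]
  exact hc.mono (Icc_subset_Icc_right hrt)

theorem fracIntegral_sum {α t : ℝ} (hα : 0 < α) {n : ℕ} {c : Fin n → ℝ → ℝ}
    (hc : ∀ i, ContinuousOn (c i) (Icc 0 t)) {U : ℝ → ℝ} {β : Fin n → ℝ}
    (hU : ∀ r ∈ Icc 0 t, U r = ∑ i, c i r * β i) {r : ℝ} (hr : r ∈ Icc 0 t) :
    fracIntegral α U r = ∑ i, fracIntegral α (c i) r * β i := by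
  unfold fracIntegral
  simp_rw [← intervalIntegral.integral_mul_const]
  rw [← intervalIntegral.integral_finsetSum
    (fun i _ => (intervalIntegrable_omega_mul hα (hc i) hr.1 hr.2).mul_const _)]
  refine intervalIntegral.integral_congr fun s hs => ?_
  rw [uIcc_of_le hr.1] at hs
  simp only [hU s ⟨hs.1, hs.2.trans hr.2⟩, Finset.mul_sum, mul_assoc]

theorem fracDeriv_sum {α t : ℝ} (hα : 0 < α) {n : ℕ} {c : Fin n → ℝ → ℝ}
    (hc : ∀ i, ContinuousOn (c i) (Icc 0 t)) {U : ℝ → ℝ} {β d : Fin n → ℝ}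
    (hU : ∀ r ∈ Icc 0 t, U r = ∑ i, c i r * β i) {s : ℝ} (hs : s ∈ Ioo 0 t)
    (hd : ∀ i, HasDerivAt (fracIntegral α (c i)) (d i) s) :
    fracDeriv α U s = ∑ i, d i * β i := by
  refine HasDerivAt.deriv ?_
  refine (HasDerivAt.fun_sum fun i _ => (hd i).mul_const (β i)).congr_of_eventuallyEq ?_
  filter_upwards [Ioo_mem_nhds hs.1 hs.2] with r hr
  exact fracIntegral_sum hα hc hU (Ioo_subset_Icc_self hr)

/-- The linear combination of the functions `b i` with coefficients `a i`. -/
def lin {n : ℕ} (b : Fin n → ℝ → ℝ) (a : Fin n → ℝ) (x : ℝ) : ℝ := ∑ i, a i * b i x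

theorem lin_add {n : ℕ} (b : Fin n → ℝ → ℝ) (ω : ℝ) (a a' : Fin n → ℝ) (x : ℝ) :
    lin b (fun i => a i * ω + a' i) x = ω * lin b a x + lin b a' x := by
  unfold lin
  rw [Finset.mul_sum, ← Finset.sum_add_distrib]
  exact Finset.sum_congr rfl fun i _ => by ring

theorem memLp_lin {n : ℕ} {b : Fin n → ℝ → ℝ} {μ : Measure ℝ} (hb : ∀ i, MemLp (b i) 2 μ)
    (a : Fin n → ℝ) : MemLp (lin b a) 2 μ :=
  memLp_finsetSum _ fun i _ => (hb i).const_mul (a i)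

/-- Cauchy–Schwarz in the coordinates. For the derivatives of an orthonormal basis this is the
inverse estimate. -/
theorem integral_lin_sq_le {n : ℕ} {b : Fin n → ℝ → ℝ} {μ : Measure ℝ}
    (hb : ∀ i, MemLp (b i) 2 μ) (a : Fin n → ℝ) :
    ∫ x, lin b a x ^ 2 ∂μ ≤ (∫ x, ∑ i, b i x ^ 2 ∂μ) * ∑ i, a i ^ 2 := by
  rw [mul_comm, ← integral_const_mul]
  refine integral_mono (memLp_lin hb a).integrable_sq
    ((integrable_finsetSum _ fun i _ => (hb i).integrable_sq).const_mul _) fun x => ?_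
  exact Finset.sum_mul_sq_le_sq_mul_sq _ _ _

theorem integral_lin_mul_lin {n : ℕ} {b : Fin n → ℝ → ℝ} {μ : Measure ℝ}
    (hb : ∀ i, MemLp (b i) 2 μ) (hon : ∀ i j, ∫ x, b i x * b j x ∂μ = if i = j then 1 else 0)
    (a a' : Fin n → ℝ) : ∫ x, lin b a x * lin b a' x ∂μ = ∑ i, a i * a' i := by
  unfold lin
  simp_rw [Finset.sum_mul_sum]
  have hi : ∀ i j, Integrable (fun x => a i * b i x * (a' j * b j x)) μ := fun i j =>
    ((integrable_mul_of_memLp_two (hb i) (hb j)).const_mul (a i * a' j)).congr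
      (ae_of_all _ fun x => by simp only; ring)
  rw [integral_finsetSum _ fun i _ => integrable_finsetSum _ fun j _ => hi i j]
  refine Finset.sum_congr rfl fun i _ => ?_
  rw [integral_finsetSum _ fun j _ => hi i j, Finset.sum_eq_single i]
  · have : ∀ x, a i * b i x * (a' i * b i x) = a i * a' i * (b i x * b i x) := fun x => by ring
    simp_rw [this, integral_const_mul, hon]
    simp
  · intro j _ hji
    have : ∀ x, a i * b i x * (a' j * b j x) = a i * a' j * (b i x * b j x) := fun x => by ring
    simp_rw [this, integral_const_mul, hon]
    simp [hji.symm]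
  · simp

instance (a : ℝ) : IsFiniteMeasure (volOn a) := by unfold volOn; infer_instance

theorem memLp_of_mem_feSpace (hnode0 : node 0 = 0) (hnodeL : node (Fin.last P) = L)
    {v : ℝ → ℝ} (hv : v ∈ feSpace L node) :
    MemLp v 2 (volOn L) ∧ MemLp (deriv v) 2 (volOn L) := by
  obtain ⟨⟨K, hK⟩, ⟨K', -, hK'⟩, -⟩ := exists_bound_of_mem_feSpace hnode0 hnodeL hv
  exact ⟨MemLp.of_bound hv.1.aestronglyMeasurable K (ae_of_all _ hK),
    MemLp.of_bound (measurable_deriv v).aestronglyMeasurable K' hK'⟩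

theorem lin_mem_feSpace {n : ℕ} {b : Fin n → ℝ → ℝ} (hb : ∀ i, b i ∈ feSpace L node)
    (a : Fin n → ℝ) : lin b a ∈ feSpace L node := by
  have : lin b a = ∑ i, a i • b i := by ext x; simp [lin]
  rw [this]
  exact (feSubmodule L node).sum_mem fun i _ => (feSubmodule L node).smul_mem _ (hb i)

theorem deriv_lin {n : ℕ} {b : Fin n → ℝ → ℝ} (hnode0 : node 0 = 0)
    (hnodeL : node (Fin.last P) = L) (hb : ∀ i, b i ∈ feSpace L node) (a : Fin n → ℝ)
    {x : ℝ} (hx : x ∈ Ioo 0 L) (hxn : ∀ p, x ≠ node p) :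
    deriv (lin b a) x = lin (fun i => deriv (b i)) a x :=
  (HasDerivAt.fun_sum fun i _ =>
    (((exists_bound_of_mem_feSpace hnode0 hnodeL (hb i)).2.2 x hx hxn).hasDerivAt.const_mul
      (a i))).deriv

theorem deriv_lin_ae {n : ℕ} {b : Fin n → ℝ → ℝ} (hnode0 : node 0 = 0)
    (hnodeL : node (Fin.last P) = L) (hb : ∀ i, b i ∈ feSpace L node) (a : Fin n → ℝ) :
    deriv (lin b a) =ᵐ[volOn L] lin (fun i => deriv (b i)) a := by
  unfold volOn
  rw [Filter.EventuallyEq, ae_restrict_iff' measurableSet_Ioo]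
  filter_upwards [ae_ne_node node] with x hxn hx
  exact deriv_lin hnode0 hnodeL hb a hx hxn

/-- The semidiscrete equation in terms of the coordinates `c i` of the solution. -/
theorem ae_coordinate_equation {α T t : ℝ} (hα : 0 < α) (hL : 0 < L) (ht : 0 ≤ t) (htT : t ≤ T)
    (hnode0 : node 0 = 0) (hnodeL : node (Fin.last P) = L) {F g gs : ℝ → ℝ → ℝ} {u₀ : ℝ → ℝ}
    {u : ℝ → ℝ → ℝ} (hu : IsSemidiscreteSolution α L T node F g gs u₀ u) {n : ℕ}
    {b : Fin n → ℝ → ℝ} (hb : ∀ i, b i ∈ feSpace L node) {c : Fin n → ℝ → ℝ}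
    (hc : ∀ i, AbsolutelyContinuousOnInterval (c i) 0 t)
    (huc : ∀ r ∈ Icc 0 t, u r = lin b (fun i => c i r)) :
    ∀ᵐ s ∂(volOn t), ∀ a : Fin n → ℝ,
      let φ := fun i => cutDeriv t (c i) s
      let d := fun i => c i 0 * ker α s + frac α (cutDeriv t (c i)) s
      let b' := fun i => deriv (b i)
      ∫ x, lin b φ x * lin b a x ∂(volOn L) + ∫ x, lin b' d x * lin b' a x ∂(volOn L)
        - ∫ x, F s x * lin b d x * lin b' a x ∂(volOn L)
      = ∫ x, g s x * lin b a x ∂(volOn L) + ∫ x, gs s x * lin b' a x ∂(volOn L) := by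
  have hcc : ∀ i, ContinuousOn (c i) (Icc 0 t) := fun i => by
    have := (hc i).continuousOn
    rwa [uIcc_of_le ht] at this
  have hle : volOn t ≤ volOn T := Measure.restrict_mono (Ioo_subset_Ioo_right htT) le_rfl
  have heq := ae_mono hle hu.equation
  have hder := ae_all_iff.2 fun i => ae_hasDerivAt_fracIntegral hα ht (hc i)
  have hmem : ∀ᵐ s ∂(volOn t), s ∈ Ioo 0 t := ae_restrict_mem measurableSet_Ioo
  filter_upwards [heq, hmem, ae_restrict_of_ae hder] with s h1 hs h2 a
  intro φ d b'
  have h3 := h1 (lin b a) (lin_mem_feSpace hb a)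
  simp only [ip_eq_integral hL] at h3
  have hda := deriv_lin_ae hnode0 hnodeL hb a
  have e1 : ∀ x, deriv (fun r => u r x) s = lin b φ x := fun x => by
    refine HasDerivAt.deriv ?_
    refine (HasDerivAt.fun_sum fun i _ => ((h2 i hs).1.mul_const (b i x))).congr_of_eventuallyEq ?_
    filter_upwards [Ioo_mem_nhds hs.1 hs.2] with r hr
    rw [huc r (Ioo_subset_Icc_self hr), lin]
  have e2 : ∀ x, fracDeriv α (fun r => u r x) s = lin b d x := fun x =>
    fracDeriv_sum hα hcc (fun r hr => by rw [huc r hr, lin]) hs fun i => (h2 i hs).2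
  have e3 : ∀ᵐ x ∂(volOn L), fracDeriv α (fun r => deriv (u r) x) s = lin b' d x := by
    unfold volOn
    rw [ae_restrict_iff' measurableSet_Ioo]
    filter_upwards [ae_ne_node node] with x hxn hx
    exact fracDeriv_sum hα hcc
      (fun r hr => by rw [huc r hr, deriv_lin hnode0 hnodeL hb _ hx hxn, lin]) hs
      fun i => (h2 i hs).2
  simp_rw [e1, e2] at h3
  have i2 : ∫ x, fracDeriv α (fun r => deriv (u r) x) s * deriv (lin b a) x ∂(volOn L)
      = ∫ x, lin b' d x * lin b' a x ∂(volOn L) := by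
    refine integral_congr_ae ?_
    filter_upwards [e3, hda] with x hx hx'
    rw [hx, hx']
  have i3 : ∫ x, F s x * lin b d x * deriv (lin b a) x ∂(volOn L)
      = ∫ x, F s x * lin b d x * lin b' a x ∂(volOn L) := by
    refine integral_congr_ae ?_
    filter_upwards [hda] with x hx'
    rw [hx']
  have i4 : ∫ x, gs s x * deriv (lin b a) x ∂(volOn L)
      = ∫ x, gs s x * lin b' a x ∂(volOn L) := by
    refine integral_congr_ae ?_
    filter_upwards [hda] with x hx'
    rw [hx']
  rw [i2, i3, i4] at h3
  exact h3

/-- The pointwise-in-time estimates obtained by testing the equation. -/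
theorem ae_estimates {α T t CF : ℝ} (hα : 0 < α) (hL : 0 < L) (ht : 0 ≤ t) (htT : t ≤ T)
    (hnode0 : node 0 = 0) (hnodeL : node (Fin.last P) = L) {F g gs : ℝ → ℝ → ℝ} {u₀ : ℝ → ℝ}
    (hF : AEStronglyMeasurable (fun z : ℝ × ℝ => F z.1 z.2) ((volOn T).prod (volOn L)))
    (hg : MemL1L2 L T g) (hgs : MemL1L2 L T gs)
    (hCF : ∀ᵐ z ∂((volOn T).prod (volOn L)), 1 + F z.1 z.2 ^ 2 ≤ CF)
    {u : ℝ → ℝ → ℝ} (hu : IsSemidiscreteSolution α L T node F g gs u₀ u) {n : ℕ}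
    {b : Fin n → ℝ → ℝ} (hb : ∀ i, b i ∈ feSpace L node)
    (hon : ∀ i j, ip L (b i) (b j) = if i = j then 1 else 0) {c : Fin n → ℝ → ℝ}
    (hc : ∀ i, AbsolutelyContinuousOnInterval (c i) 0 t)
    (huc : ∀ r ∈ Icc 0 t, u r = lin b (fun i => c i r)) :
    ∃ K : ℝ, 0 ≤ K ∧ ∀ᵐ s ∂(volOn t),
      MemLp (g s) 2 (volOn L) ∧ MemLp (gs s) 2 (volOn L) ∧
      ∑ i, cutDeriv t (c i) s * frac α (cutDeriv t (c i)) s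
        ≤ CF / 2 * ∑ i, frac α (cutDeriv t (c i)) s ^ 2
          + (1 / 2 * ∫ x, g s x ^ 2 ∂(volOn L) + ∫ x, gs s x ^ 2 ∂(volOn L))
          + CF * ker α s ^ 2 *
            (∫ x, u₀ x ^ 2 ∂(volOn L) + ∫ x, deriv u₀ x ^ 2 ∂(volOn L)) ∧
      ∑ i, cutDeriv t (c i) s ^ 2 ≤ K * ((1 / 2 * ∫ x, g s x ^ 2 ∂(volOn L)
          + ∫ x, gs s x ^ 2 ∂(volOn L))
          + ∑ i, (c i 0 * ker α s + frac α (cutDeriv t (c i)) s) ^ 2) := by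
  have hbm : ∀ i, MemLp (b i) 2 (volOn L) := fun i => (memLp_of_mem_feSpace hnode0 hnodeL (hb i)).1
  have hbm' : ∀ i, MemLp ((fun i => deriv (b i)) i) 2 (volOn L) := fun i =>
    (memLp_of_mem_feSpace hnode0 hnodeL (hb i)).2
  have hon' : ∀ i j, ∫ x, b i x * b j x ∂(volOn L) = if i = j then 1 else 0 := fun i j => by
    rw [← ip_eq_integral hL, hon]
  set C := ∫ x, ∑ i, (fun i => deriv (b i)) i x ^ 2 ∂(volOn L) with hC
  have hC0 : 0 ≤ C := integral_nonneg fun x => by positivity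
  have hu0 : u₀ = lin b (fun i => c i 0) := by
    rw [← huc 0 (left_mem_Icc.2 ht), hu.initial]
  have hle : volOn t ≤ volOn T := Measure.restrict_mono (Ioo_subset_Ioo_right htT) le_rfl
  have hsq : ∀ a : Fin n → ℝ, ∫ x, lin b a x ^ 2 ∂(volOn L) = ∑ i, a i ^ 2 := fun a => by
    simp_rw [sq]
    exact integral_lin_mul_lin hbm hon' a a
  set K1 := 6 * (C + 1) * (1 + C + |CF|) with hK1
  have hK1' : 0 ≤ 6 * (C + 1) * (C + |CF|) := by positivity
  have hK1'' : 0 ≤ 6 * (C + 1) := by positivity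
  refine ⟨4 + K1, by positivity, ?_⟩
  filter_upwards [ae_coordinate_equation hα hL ht htT hnode0 hnodeL hu hb hc huc,
    ae_mono hle (ae_memLp_of_memL1L2 hg), ae_mono hle (ae_memLp_of_memL1L2 hgs),
    ae_mono hle hF.prodMk_left, ae_mono hle (Measure.ae_ae_of_ae_prod hCF)]
    with s heq hgm hgsm hFm hFb
  refine ⟨hgm, hgsm, ?_, ?_⟩
  -- Test with I^α u_t: this gives the energy inequality.
  · have h := heq (fun i => frac α (cutDeriv t (c i)) s)
    simp only [lin_add] at h
    have := energy_estimate (F := F s) hFm hFb (ker α s) hgm hgsm (memLp_lin hbm _)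
      (memLp_lin hbm' _) (memLp_lin hbm fun i => c i 0) (memLp_lin hbm' fun i => c i 0) h
    rw [integral_lin_mul_lin hbm hon', hsq] at this
    have e : ∫ x, deriv u₀ x ^ 2 ∂(volOn L)
        = ∫ x, lin (fun i => deriv (b i)) (fun i => c i 0) x ^ 2 ∂(volOn L) := by
      refine integral_congr_ae ?_
      rw [hu0]
      filter_upwards [deriv_lin_ae hnode0 hnodeL hb fun i => c i 0] with x hx
      rw [hx]
    rw [e, hu0]
    exact this
  -- Test with u_t: this gives the bound on u_t itself. Its constant depends on the mesh through C,
  -- but it serves only to prove square integrability.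
  · have h := heq (fun i => cutDeriv t (c i) s)
    have hd := integral_lin_sq_le hbm'
      (fun i => c i 0 * ker α s + frac α (cutDeriv t (c i)) s)
    have := derivative_estimate (F := F s) hFm hFb hC0 hgm hgsm (memLp_lin hbm _)
      (memLp_lin hbm' _) (memLp_lin hbm _) (memLp_lin hbm' _)
      (by rw [hsq]; exact integral_lin_sq_le hbm' _) h
    rw [hsq, hsq] at this
    refine this.trans ?_
    set D := ∑ i, (c i 0 * ker α s + frac α (cutDeriv t (c i)) s) ^ 2
    have hD : 0 ≤ D := Finset.sum_nonneg fun i _ => sq_nonneg _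
    have hG : 0 ≤ ∫ x, g s x ^ 2 ∂(volOn L) := integral_nonneg fun x => sq_nonneg _
    have hGs : 0 ≤ ∫ x, gs s x ^ 2 ∂(volOn L) := integral_nonneg fun x => sq_nonneg _
    set G := ∫ x, g s x ^ 2 ∂(volOn L)
    set Gs := ∫ x, gs s x ^ 2 ∂(volOn L)
    have h1 : Gs + ∫ x, lin (fun i => deriv (b i))
        (fun i => c i 0 * ker α s + frac α (cutDeriv t (c i)) s) x ^ 2 ∂(volOn L) + CF * D
        ≤ Gs + (C + |CF|) * D := by
      have : CF * D ≤ |CF| * D := by gcongr; exact le_abs_self _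
      linarith
    have h2 : 6 * (C + 1) * (Gs + (C + |CF|) * D) ≤ K1 * (1 / 2 * G + Gs + D) := by
      rw [hK1]
      have e : 6 * (C + 1) * (1 + C + |CF|) * (1 / 2 * G + Gs + D)
        - 6 * (C + 1) * (Gs + (C + |CF|) * D)
        = 6 * (C + 1) * ((1 + C + |CF|) * (1 / 2 * G) + (C + |CF|) * Gs + D) := by ring
      have : 0 ≤ 6 * (C + 1) * ((1 + C + |CF|) * (1 / 2 * G) + (C + |CF|) * Gs + D) := by
        positivity
      linarith
    have h3 := mul_le_mul_of_nonneg_left h1 hK1''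
    linarith

/-! ### Integration in time and the stability bound -/

theorem ofReal_integral_le_lintegral_ofReal {X : Type*} [MeasurableSpace X] {μ : Measure X}
    {h : X → ℝ} (hi : Integrable h μ) :
    ENNReal.ofReal (∫ x, h x ∂μ) ≤ ∫⁻ x, ENNReal.ofReal (h x) ∂μ := by
  have h1 : ∫ x, h x ∂μ ≤ ∫ x, max (h x) 0 ∂μ :=
    integral_mono hi hi.pos_part fun x => le_max_left _ _
  refine (ENNReal.ofReal_le_ofReal h1).trans_eq ?_
  rw [ofReal_integral_eq_lintegral_ofReal hi.pos_part (ae_of_all _ fun x => le_max_right _ _)]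
  refine lintegral_congr fun x => ?_
  rcases le_total (h x) 0 with h2 | h2
  · simp [h2, ENNReal.ofReal_of_nonpos h2]
  · simp [h2]

theorem enorm_sq_eq_ofReal (x : ℝ) : ‖x‖ₑ ^ 2 = ENNReal.ofReal (x ^ 2) := by
  rw [← sq_abs, ENNReal.ofReal_pow (abs_nonneg _), ← Real.enorm_eq_ofReal_abs]

theorem memLp_two_volOn {t : ℝ} {f : ℝ → ℝ} (hf : Measurable f)
    (h : ∫⁻ s in Ioo 0 t, ‖f s‖ₑ ^ 2 < ∞) : MemLp f 2 (volOn t) := by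
  refine ⟨hf.aestronglyMeasurable, ?_⟩
  have h' : sqNorm t f < ∞ := by rw [sqNorm_eq_lintegral]; exact h
  unfold sqNorm at h'
  exact ENNReal.pow_lt_top_iff.1 h' |>.resolve_right (by norm_num)

theorem lintegral_sq_lt_top_of_memLp {t : ℝ} {f : ℝ → ℝ} (h : MemLp f 2 (volOn t)) :
    ∫⁻ s in Ioo 0 t, ‖f s‖ₑ ^ 2 < ∞ := by
  have := ENNReal.pow_lt_top h.2 (n := 2)
  have e := sqNorm_eq_lintegral t f
  unfold sqNorm at e
  rw [e] at this
  exact this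

theorem fracE_sum (β : ℝ) {n : ℕ} {f : Fin n → ℝ → ℝ≥0∞} (hf : ∀ i, Measurable (f i)) (r : ℝ) :
    fracE β (fun s => ∑ i, f i s) r = ∑ i, fracE β (f i) r := by
  unfold fracE
  simp_rw [Finset.mul_sum]
  exact lintegral_finsetSum _ fun i _ => by have := hf i; fun_prop

theorem absolutelyContinuousOnInterval_sum {ι : Type*} (s : Finset ι) {f : ι → ℝ → ℝ} {a b : ℝ}
    (hf : ∀ i, AbsolutelyContinuousOnInterval (f i) a b) :
    AbsolutelyContinuousOnInterval (fun x => ∑ i ∈ s, f i x) a b := by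
  classical
  induction s using Finset.induction_on with
  | empty =>
    simpa using (LipschitzWith.const (0 : ℝ)).lipschitzOnWith.absolutelyContinuousOnInterval
  | insert i s hi ih =>
    simp_rw [Finset.sum_insert hi]
    exact (hf i).add ih

/-- The stability estimate for coordinates, given the pointwise energy estimate. -/
theorem sum_enorm_sq_le {α t CF : ℝ} (hα : 1 / 2 < α) (hα1 : α < 1) (ht : 0 < t) (hCF : 0 ≤ CF)
    {n : ℕ} {φ : Fin n → ℝ → ℝ} (hφm : ∀ i, Measurable (φ i)) (hφ0 : ∀ i, ∀ s ≤ 0, φ i s = 0)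
    (hφ1 : ∀ i, ∫⁻ s, ‖φ i s‖ₑ ≠ ∞) (hφ2 : ∀ i, ∫⁻ s, ‖φ i s‖ₑ ^ 2 ≠ ∞) {G : ℝ → ℝ≥0∞} {H : ℝ≥0∞}
    (hen : ∀ᵐ s ∂(volOn t), ENNReal.ofReal (∑ i, φ i s * frac α (φ i) s) ≤
      (ENNReal.ofReal (CF / 2) * ∑ i, ‖frac α (φ i) s‖ₑ ^ 2
        + ENNReal.ofReal CF * kerE α s ^ 2 * H) + G s) :
    ∑ i, ‖∫ s in Ioo 0 t, φ i s‖ₑ ^ 2 ≤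
      ENNReal.ofReal (mittagLeffler (α / 2) (5 / 8 * CF * t ^ α / (1 - α)) / (1 - α) ^ 2) *
        (ENNReal.ofReal (t ^ (1 - α)) * (∫⁻ s in Ioo 0 t, G s)
          + ENNReal.ofReal (CF * t ^ α / (2 * α - 1)) * H) := by
  set β := α / 2 with hβ
  have hβ0 : 0 < β := by linarith
  have hβ1 : β < 1 / 2 := by linarith
  have hα' : 0 < 1 - α := by linarith
  have h2α : 0 < 2 * α - 1 := by linarith
  have h2β : 2 * β = α := by rw [hβ]; ring
  let N : Fin n → ℝ → ℝ≥0∞ := fun i s => ‖frac β (φ i) s‖ₑ ^ 2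
  have hNm : ∀ i, Measurable (N i) := fun i => by
    have := hφm i
    simp only [N]; fun_prop
  have hN0 : ∀ i, ∀ s ≤ 0, N i s = 0 := fun i s hs => by simp [N, frac_eq_zero (hφ0 i) hs]
  let S : ℝ → ℝ≥0∞ := fun r => ∑ i, fracE 1 (N i) r
  set A := (∫⁻ s in Ioo 0 t, G s) +
    ENNReal.ofReal (CF * (t ^ (2 * α - 1) / (2 * α - 1))) * H with hA
  have hcoer := fun i r => cos_mul_setLIntegral_sq_frac_le hβ0 hβ1 (hφm i) (hφ0 i) (hφ2 i) r
  rw [h2β] at hcoer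
  have hSeq : ∀ r, S r = ∑ i, ∫⁻ s in Ioo 0 r, ‖frac β (φ i) s‖ₑ ^ 2 := fun r =>
    Finset.sum_congr rfl fun i _ => (setLIntegral_Ioo_eq_fracE (hN0 i) r).symm
  have hStop : S t ≠ ∞ := by
    rw [hSeq]
    exact (ENNReal.sum_lt_top.2 fun i _ => (hcoer i t).2.2.1).ne
  have hSmono : ∀ r ≤ t, S r ≤ S t := fun r hr => Finset.sum_le_sum fun i _ => by
    rw [fracE_one, fracE_one]
    exact lintegral_mono_set (Iio_subset_Iio hr)
  have hS0 : ∀ s ≤ 0, S s = 0 := fun s hs =>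
    Finset.sum_eq_zero fun i _ => fracE_eq_zero (hN0 i) hs
  have hstep : ∀ r, 0 < r → r ≤ t → ENNReal.ofReal (1 - α) * S r ≤
      A + ENNReal.ofReal (5 / 8 * CF * t ^ β) * fracE β S r := by
    intro r hr hrt
    have hΓα := one_le_Gamma (by linarith : 0 < α) hα1.le
    have hΓβ := four_fifths_le_Gamma (x := 1 + β) (by linarith) (by linarith)
    have hcos : 1 - α ≤ Real.cos (Real.pi * β) := one_sub_le_cos (by linarith) hα1.le
    have hle : volOn r ≤ volOn t := Measure.restrict_mono (Ioo_subset_Ioo_right hrt) le_rfl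
    have hk2 : ∫⁻ s in Ioo 0 r, kerE α s ^ 2 ≤
        ENNReal.ofReal (t ^ (2 * α - 1) / (2 * α - 1)) := by
      rw [setLIntegral_Ioo_kerE_sq hα hr]
      refine ENNReal.ofReal_le_ofReal ?_
      have : r ^ (2 * α - 1) ≤ t ^ (2 * α - 1) := Real.rpow_le_rpow hr.le hrt h2α.le
      gcongr
      exact le_mul_of_one_le_right h2α.le (one_le_pow₀ hΓα)
    -- The factor ½ C_F of the energy estimate meets 1/Γ(1+β) ≤ 5/4 from Jensen's mass.
    have hk1 : ENNReal.ofReal (CF / 2) * kerE (1 + β) r ≤ ENNReal.ofReal (5 / 8 * CF * t ^ β) := by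
      rw [kerE, ← ENNReal.ofReal_mul (by positivity), ker_of_pos hr, add_sub_cancel_left]
      refine ENNReal.ofReal_le_ofReal ?_
      have h1 : r ^ β ≤ t ^ β := Real.rpow_le_rpow hr.le hrt hβ0.le
      have h2 : r ^ β / Real.Gamma (1 + β) ≤ t ^ β / (4 / 5) := by gcongr
      calc CF / 2 * (r ^ β / Real.Gamma (1 + β)) ≤ CF / 2 * (t ^ β / (4 / 5)) := by gcongr
        _ = _ := by ring
    have hfm : Measurable fun s => ENNReal.ofReal (CF / 2) * ∑ i, ‖frac α (φ i) s‖ₑ ^ 2 := by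
      refine measurable_const.mul (Finset.measurable_fun_sum _ fun i _ => ?_)
      have := hφm i
      fun_prop
    have hfm' : Measurable fun s => ENNReal.ofReal (CF / 2) * ∑ i, ‖frac α (φ i) s‖ₑ ^ 2
        + ENNReal.ofReal CF * kerE α s ^ 2 * H := hfm.add (by fun_prop)
    calc ENNReal.ofReal (1 - α) * S r
        ≤ ENNReal.ofReal (Real.cos (Real.pi * β)) * S r := by
          gcongr
      _ = ∑ i, ENNReal.ofReal (Real.cos (Real.pi * β)) *
            ∫⁻ s in Ioo 0 r, ‖frac β (φ i) s‖ₑ ^ 2 := by rw [hSeq, Finset.mul_sum]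
      _ ≤ ∑ i, ENNReal.ofReal (∫ s in Ioo 0 r, φ i s * frac α (φ i) s) :=
          Finset.sum_le_sum fun i _ => (hcoer i r).2.2.2
      _ = ENNReal.ofReal (∫ s in Ioo 0 r, ∑ i, φ i s * frac α (φ i) s) := by
          rw [integral_finsetSum _ fun i _ => (hcoer i r).1,
            ENNReal.ofReal_sum_of_nonneg fun i _ => (hcoer i r).2.1]
      _ ≤ ∫⁻ s in Ioo 0 r, ENNReal.ofReal (∑ i, φ i s * frac α (φ i) s) :=
          ofReal_integral_le_lintegral_ofReal (integrable_finsetSum _ fun i _ => (hcoer i r).1)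
      _ ≤ ∫⁻ s in Ioo 0 r, ((ENNReal.ofReal (CF / 2) * ∑ i, ‖frac α (φ i) s‖ₑ ^ 2
            + ENNReal.ofReal CF * kerE α s ^ 2 * H) + G s) := lintegral_mono_ae (ae_mono hle hen)
      _ = ENNReal.ofReal (CF / 2) * ∑ i, (∫⁻ s in Ioo 0 r, ‖frac α (φ i) s‖ₑ ^ 2)
            + ENNReal.ofReal CF * (∫⁻ s in Ioo 0 r, kerE α s ^ 2) * H
            + ∫⁻ s in Ioo 0 r, G s := by
          rw [lintegral_add_left hfm', lintegral_add_left hfm,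
            lintegral_mul_const _ (by fun_prop), lintegral_const_mul _ (by fun_prop),
            lintegral_const_mul' _ _ ENNReal.ofReal_ne_top,
            lintegral_finsetSum _ fun i _ => by have := hφm i; fun_prop]
      _ ≤ ENNReal.ofReal (CF / 2) * ∑ i, kerE (1 + β) r * fracE β (fracE 1 (N i)) r
            + ENNReal.ofReal CF * ENNReal.ofReal (t ^ (2 * α - 1) / (2 * α - 1)) * H
            + ∫⁻ s in Ioo 0 t, G s := by
          gcongr with i
          have := setLIntegral_Ioo_sq_frac_two_mul_le hβ0 (hφm i) (hφ0 i) (hφ2 i) r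
          rwa [h2β] at this
      _ = A + (ENNReal.ofReal (CF / 2) * kerE (1 + β) r) * fracE β S r := by
          rw [← Finset.mul_sum, ← fracE_sum β fun i => measurable_fracE 1 (hNm i), hA,
            ENNReal.ofReal_mul hCF]
          simp only [S]
          ring
      _ ≤ _ := by gcongr
  have hinv : ENNReal.ofReal (1 / (1 - α)) * ENNReal.ofReal (1 - α) = 1 := by
    rw [← ENNReal.ofReal_mul (by positivity), one_div_mul_cancel hα'.ne', ENNReal.ofReal_one]
  have hgr : ∀ s, 0 < s → s ≤ t → S s ≤ ENNReal.ofReal (1 / (1 - α)) * A +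
      ENNReal.ofReal (5 / 8 * CF * t ^ β / (1 - α)) * fracE β S s := by
    intro s hs hst
    calc S s = ENNReal.ofReal (1 / (1 - α)) * (ENNReal.ofReal (1 - α) * S s) := by
          rw [← mul_assoc, hinv, one_mul]
      _ ≤ ENNReal.ofReal (1 / (1 - α)) *
          (A + ENNReal.ofReal (5 / 8 * CF * t ^ β) * fracE β S s) := by
          gcongr
          exact hstep s hs hst
      _ = _ := by
          rw [mul_add, ← mul_assoc (ENNReal.ofReal (1 / (1 - α))) (ENNReal.ofReal _),
            ← ENNReal.ofReal_mul (by positivity)]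
          congr 3
          ring
  have hfin := le_mul_mittagLeffler hβ0 (by positivity) ht hStop hS0 hSmono hgr
  -- One t^β comes from Jensen's mass, the other from Gronwall; together they form t^α.
  have hz : 5 / 8 * CF * t ^ β / (1 - α) * t ^ β = 5 / 8 * CF * t ^ α / (1 - α) := by
    have : t ^ α = t ^ β * t ^ β := by rw [← Real.rpow_add ht]; congr 1; linarith
    rw [this]; ring
  rw [hz] at hfin
  set E := mittagLeffler β (5 / 8 * CF * t ^ α / (1 - α)) with hE
  have hE0 : 0 < E := mittagLeffler_pos hβ0 (by positivity)
  -- One factor 1/(1-α) came from coercivity; the second comes from the L₂ norm of ω_{1-β}, where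
  -- Γ(1-β) ≥ 1 is dropped.
  have hΓ := one_le_Gamma (by linarith : 0 < 1 - β) (by linarith)
  calc _ ≤ ∑ i, ENNReal.ofReal (t ^ (1 - α) / (1 - α)) *
        ∫⁻ s in Ioo 0 t, ‖frac β (φ i) s‖ₑ ^ 2 := by
        refine Finset.sum_le_sum fun i _ => ?_
        have h := enorm_setIntegral_sq_le hβ0 hβ1 (hφm i) (hφ0 i) (hφ1 i) ht
        rw [h2β] at h
        refine h.trans ?_
        gcongr
        exact le_mul_of_one_le_right hα'.le (one_le_pow₀ hΓ)
    _ = ENNReal.ofReal (t ^ (1 - α) / (1 - α)) * S t := by rw [hSeq, Finset.mul_sum]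
    _ ≤ ENNReal.ofReal (t ^ (1 - α) / (1 - α)) *
        (ENNReal.ofReal (1 / (1 - α)) * A * ENNReal.ofReal E) := by gcongr
    _ = _ := by
        have e1 : ENNReal.ofReal (t ^ (1 - α) / (1 - α)) * ENNReal.ofReal (1 / (1 - α)) *
            ENNReal.ofReal E = ENNReal.ofReal (E / (1 - α) ^ 2) * ENNReal.ofReal (t ^ (1 - α)) := by
          rw [← ENNReal.ofReal_mul (by positivity), ← ENNReal.ofReal_mul (by positivity),
            ← ENNReal.ofReal_mul (by positivity)]
          congr 1
          field_simp
        have e2 : ENNReal.ofReal (t ^ (1 - α)) *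
            ENNReal.ofReal (CF * (t ^ (2 * α - 1) / (2 * α - 1)))
            = ENNReal.ofReal (CF * t ^ α / (2 * α - 1)) := by
          rw [← ENNReal.ofReal_mul (by positivity),
            show t ^ α = t ^ (1 - α) * t ^ (2 * α - 1) by rw [← Real.rpow_add ht]; congr 1; ring]
          congr 1
          ring
        rw [← e2]
        calc _ = (ENNReal.ofReal (t ^ (1 - α) / (1 - α)) * ENNReal.ofReal (1 / (1 - α)) *
            ENNReal.ofReal E) * A := by ring
          _ = _ := by rw [e1, hA]; ring

/-- Square integrability of the time derivatives of the coordinates. -/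
theorem lintegral_sq_cutDeriv_ne_top {α t K : ℝ} (hα : 1 / 2 < α) (ht : 0 < t)
    {n : ℕ} {c : Fin n → ℝ → ℝ} (hc : ∀ i, AbsolutelyContinuousOnInterval (c i) 0 t)
    {G : ℝ → ℝ} (hG0 : ∀ s, 0 ≤ G s) (hK : 0 ≤ K)
    (hG : ∫⁻ s in Ioo 0 t, ENNReal.ofReal (G s) ≠ ∞)
    (h : ∀ᵐ s ∂(volOn t), ∑ i, cutDeriv t (c i) s ^ 2 ≤
      K * (G s + ∑ i, (c i 0 * ker α s + frac α (cutDeriv t (c i)) s) ^ 2)) (i : Fin n) :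
    ∫⁻ s, ‖cutDeriv t (c i) s‖ₑ ^ 2 ≠ ∞ := by
  have hα0 : 0 < α := by linarith
  -- These coordinates of the fractional derivative are square integrable since α > 1/2: ω_α lies in
  -- L₂(0, t), and I^α maps L₁ into L₂ there.
  let d : Fin n → ℝ → ℝ := fun j s => c j 0 * ker α s + frac α (cutDeriv t (c j)) s
  have hdm : ∀ j, Measurable (d j) := fun j => by fun_prop
  have hd : ∀ j, ∫⁻ s in Ioo 0 t, ‖d j s‖ₑ ^ 2 < ∞ := by
    intro j
    refine lintegral_sq_lt_top_of_memLp (MemLp.add (MemLp.const_mul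
      (memLp_two_volOn (by fun_prop) ?_) _) (memLp_two_volOn (by fun_prop) ?_))
    · simp_rw [enorm_ker hα0]
      rw [setLIntegral_Ioo_kerE_sq hα ht]
      exact ENNReal.ofReal_lt_top
    · refine lt_of_le_of_lt (lintegral_mono fun s =>
        pow_le_pow_left' (enorm_frac_le hα0 (cutDeriv t (c j)) s) 2) ?_
      exact setLIntegral_Ioo_sq_fracE_lt_top_of_integrable hα (by fun_prop)
        (fun s hs => by simp [cutDeriv_of_nonpos s hs]) (lintegral_enorm_cutDeriv ht.le (hc j)) t
  have e : ∫⁻ s, ‖cutDeriv t (c i) s‖ₑ ^ 2 = ∫⁻ s in Ioo 0 t, ‖cutDeriv t (c i) s‖ₑ ^ 2 := by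
    rw [← lintegral_indicator measurableSet_Ioo]
    refine lintegral_congr fun s => ?_
    by_cases hs : s ∈ Ioo 0 t
    · rw [indicator_of_mem hs]
    · rw [indicator_of_notMem hs, cutDeriv, indicator_of_notMem hs]; simp
  rw [e]
  have hle : ∀ᵐ s ∂(volOn t), ‖cutDeriv t (c i) s‖ₑ ^ 2 ≤
      ENNReal.ofReal K * (ENNReal.ofReal (G s) + ∑ j, ‖d j s‖ₑ ^ 2) := by
    filter_upwards [h] with s hs
    simp_rw [enorm_sq_eq_ofReal]
    rw [← ENNReal.ofReal_sum_of_nonneg fun j _ => sq_nonneg _,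
      ← ENNReal.ofReal_add (hG0 s) (Finset.sum_nonneg fun j _ => sq_nonneg _),
      ← ENNReal.ofReal_mul hK]
    refine ENNReal.ofReal_le_ofReal (le_trans ?_ hs)
    exact Finset.single_le_sum (f := fun j => cutDeriv t (c j) s ^ 2)
      (fun j _ => sq_nonneg _) (Finset.mem_univ i)
  refine ((lintegral_mono_ae hle).trans_lt ?_).ne
  rw [lintegral_const_mul' _ _ ENNReal.ofReal_ne_top, lintegral_add_right _
    (Finset.measurable_fun_sum _ fun j _ => by have := hdm j; fun_prop),
    lintegral_finsetSum _ fun j _ => by have := hdm j; fun_prop]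
  exact ENNReal.mul_lt_top ENNReal.ofReal_lt_top
    (ENNReal.add_lt_top.2 ⟨hG.lt_top, ENNReal.sum_lt_top.2 fun j _ => hd j⟩)

/-- An almost-everywhere bound on a set of positive measure holds at some point. -/
theorem one_le_of_ae_bound {L T CF : ℝ} (hL : 0 < L) (hT : 0 < T) {F : ℝ → ℝ → ℝ}
    (hCF : ∀ᵐ z ∂((volOn T).prod (volOn L)), 1 + F z.1 z.2 ^ 2 ≤ CF) : 1 ≤ CF := by
  have hne : (volOn T).prod (volOn L) ≠ 0 := by
    rw [← Measure.measure_univ_ne_zero, ← univ_prod_univ, Measure.prod_prod]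
    simp [volOn, hL, hT]
  have := ae_neBot.2 hne
  obtain ⟨z, hz⟩ := hCF.exists
  nlinarith [sq_nonneg (F z.1 z.2)]

end FracFP

theorem theorem3p3
    (α L T CF : ℝ) (hα : 1 / 2 < α) (hα1 : α < 1) (hL : 0 < L) (hT : 0 < T)
    {P : ℕ} (node : Fin (P + 1) → ℝ) (hnode : StrictMono node)
    (hnode0 : node 0 = 0) (hnodeL : node (Fin.last P) = L)
    (F g gs : ℝ → ℝ → ℝ)
    (hF : FracFP.MemW1Inf L T F)
    (hg : FracFP.MemL1L2 L T g) (hgs : FracFP.MemL1L2 L T gs)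
    (hCF : ∀ᵐ z ∂((FracFP.volOn T).prod (FracFP.volOn L)), 1 + F z.1 z.2 ^ 2 ≤ CF)
    (u₀ : ℝ → ℝ) (hu₀ : u₀ ∈ FracFP.feSpace L node)
    (u : ℝ → ℝ → ℝ)
    (hu : FracFP.IsSemidiscreteSolution α L T node F g gs u₀ u) :
    ∀ t ∈ Icc 0 T,
      FracFP.sqNorm L (fun x => u t x - u₀ x) ≤
        ENNReal.ofReal
            (FracFP.mittagLeffler (α / 2) (5 / 8 * CF * t ^ α / (1 - α)) / (1 - α) ^ 2) *
          (ENNReal.ofReal (t ^ (1 - α)) *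
              (∫⁻ s in Ioo 0 t, ((1 / 2) * FracFP.sqNorm L (g s) + FracFP.sqNorm L (gs s)))
            + ENNReal.ofReal (CF * t ^ α / (2 * α - 1)) * FracFP.sqNormH1 L u₀) := by
  intro t htT
  have hCF1 := FracFP.one_le_of_ae_bound hL hT hCF
  have hα' : 0 < 1 - α := by linarith
  rcases htT.1.eq_or_lt with rfl | ht
  · simp [hu.initial, FracFP.sqNorm_eq_lintegral]
  have hE : 0 < FracFP.mittagLeffler (α / 2) (5 / 8 * CF * t ^ α / (1 - α)) / (1 - α) ^ 2 :=
    div_pos (FracFP.mittagLeffler_pos (by linarith) (by positivity)) (by positivity)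
  -- If the data integral is infinite, so is the right side, because t^(1-α) and the Mittag-Leffler
  -- factor are positive. Otherwise its finiteness is what makes u_t square integrable.
  by_cases hGt : ∫⁻ s in Ioo 0 t, ((1 / 2) * FracFP.sqNorm L (g s) + FracFP.sqNorm L (gs s)) = ∞
  · rw [hGt, ENNReal.mul_top (by simpa using Real.rpow_pos_of_pos ht (1 - α)), top_add,
      ENNReal.mul_top (by simpa using hE)]
    exact le_top
  obtain ⟨n, b, m, hb, hon, hexp⟩ := FracFP.exists_orthonormal_basis hL hnode hnode0 hnodeL
  let c : Fin n → ℝ → ℝ := fun i r => ∑ p, m i p * u r (node p)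
  have hnodeI : ∀ p, node p ∈ Icc 0 L := fun p => by
    rw [← hnode0, ← hnodeL]
    exact ⟨hnode.monotone (Fin.zero_le _), hnode.monotone (Fin.le_last _)⟩
  have hc : ∀ i, AbsolutelyContinuousOnInterval (c i) 0 t := fun i =>
    FracFP.absolutelyContinuousOnInterval_sum _ fun p =>
      ((hu.absCont _ (hnodeI p)).const_mul (m i p)).mono (by
        rw [uIcc_of_le ht.le, uIcc_of_le hT.le]; exact Icc_subset_Icc_right htT.2)
  have huc : ∀ r ∈ Icc 0 t, u r = FracFP.lin b (fun i => c i r) := fun r hr => by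
    funext x
    exact hexp _ (hu.mem r ⟨hr.1, hr.2.trans htT.2⟩) x
  obtain ⟨K, hK, hest⟩ := FracFP.ae_estimates (by linarith) hL ht.le htT.2 hnode0 hnodeL hF.1.1
    hg hgs hCF hu hb hon hc huc
  have hGeq : ∀ᵐ s ∂(FracFP.volOn t),
      ENNReal.ofReal (1 / 2 * ∫ x, g s x ^ 2 ∂(FracFP.volOn L)
        + ∫ x, gs s x ^ 2 ∂(FracFP.volOn L))
      = (1 / 2) * FracFP.sqNorm L (g s) + FracFP.sqNorm L (gs s) := by
    filter_upwards [hest] with s hs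
    have h1 : 0 ≤ ∫ x, g s x ^ 2 ∂(FracFP.volOn L) := integral_nonneg fun _ => sq_nonneg _
    have h2 : 0 ≤ ∫ x, gs s x ^ 2 ∂(FracFP.volOn L) := integral_nonneg fun _ => sq_nonneg _
    rw [FracFP.sqNorm_eq_ofReal hs.1, FracFP.sqNorm_eq_ofReal hs.2.1,
      ENNReal.ofReal_add (by positivity) h2, ENNReal.ofReal_mul (by norm_num)]
    congr 2
    rw [ENNReal.ofReal_div_of_pos two_pos]
    simp
  have hφ2 := FracFP.lintegral_sq_cutDeriv_ne_top hα ht hc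
    (fun s => add_nonneg (mul_nonneg (by norm_num) (integral_nonneg fun _ => sq_nonneg _))
      (integral_nonneg fun _ => sq_nonneg _)) hK
    (fun h => hGt ((lintegral_congr_ae hGeq).symm.trans h))
    (hest.mono fun s hs => hs.2.2.2)
  have hu₀m := FracFP.memLp_of_mem_feSpace hnode0 hnodeL hu₀
  have hbm : ∀ i, MemLp (b i) 2 (FracFP.volOn L) := fun i =>
    (FracFP.memLp_of_mem_feSpace hnode0 hnodeL (hb i)).1
  have hmain := FracFP.sum_enorm_sq_le hα hα1 ht (zero_le_one.trans hCF1)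
    (φ := fun i => FracFP.cutDeriv t (c i)) (fun i => by fun_prop)
    (fun i => FracFP.cutDeriv_of_nonpos) (fun i => FracFP.lintegral_enorm_cutDeriv ht.le (hc i))
    hφ2 (G := fun s => (1 / 2) * FracFP.sqNorm L (g s) + FracFP.sqNorm L (gs s))
    (H := FracFP.sqNormH1 L u₀) (by
      filter_upwards [hest, hGeq] with s hs hGs
      have h1 : 0 ≤ ∫ x, g s x ^ 2 ∂(FracFP.volOn L) := integral_nonneg fun _ => sq_nonneg _
      have h2 : 0 ≤ ∫ x, gs s x ^ 2 ∂(FracFP.volOn L) := integral_nonneg fun _ => sq_nonneg _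
      have h3 : 0 ≤ ∫ x, u₀ x ^ 2 ∂(FracFP.volOn L) := integral_nonneg fun _ => sq_nonneg _
      have h4 : 0 ≤ ∫ x, deriv u₀ x ^ 2 ∂(FracFP.volOn L) := integral_nonneg fun _ => sq_nonneg _
      rw [← hGs, FracFP.kerE_sq (by linarith), FracFP.sqNormH1, FracFP.sqNorm_eq_ofReal hu₀m.1,
        FracFP.sqNorm_eq_ofReal hu₀m.2]
      simp_rw [FracFP.enorm_sq_eq_ofReal]
      rw [← ENNReal.ofReal_sum_of_nonneg fun j _ => sq_nonneg _,
        ← ENNReal.ofReal_mul (by positivity), ← ENNReal.ofReal_add h3 h4,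
        ← ENNReal.ofReal_mul (by positivity), ← ENNReal.ofReal_mul (by positivity),
        ← ENNReal.ofReal_add (by positivity) (by positivity),
        ← ENNReal.ofReal_add (by positivity) (by positivity)]
      refine ENNReal.ofReal_le_ofReal (hs.2.2.1.trans (le_of_eq ?_))
      ring)
  -- By orthonormality (Parseval), the left side is the sum of the squared increments of the
  -- coordinates, each the integral of its derivative.
  refine le_trans (le_of_eq ?_) hmain
  have hdiff : (fun x => u t x - u₀ x) = FracFP.lin b (fun i => c i t - c i 0) := by
    funext x
    rw [← hu.initial, huc t ⟨ht.le, le_rfl⟩, huc 0 ⟨le_rfl, ht.le⟩]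
    simp only [FracFP.lin, ← Finset.sum_sub_distrib, sub_mul]
  rw [hdiff, FracFP.sqNorm_eq_ofReal (FracFP.memLp_lin hbm _)]
  simp_rw [sq (FracFP.lin b _ _)]
  rw [FracFP.integral_lin_mul_lin hbm
    (fun i j => by rw [← FracFP.ip_eq_integral hL, hon])]
  simp_rw [FracFP.integral_cutDeriv (hc _) ht.le le_rfl, FracFP.enorm_sq_eq_ofReal]
  rw [← ENNReal.ofReal_sum_of_nonneg fun j _ => sq_nonneg _]
  simp_rw [sq]
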